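/- Let $E$ be the set of edges of the nearest-neighbour graph on $\mathbb{Z}^2$, and let $|v|$ denote the $\ell^1$-norm of $v\in\mathbb{Z}^2$. For $v\neq 0$, a flow from $0$ to $v$ is an antisymmetric function $\theta$ on the oriented edges such that $\sum_{y\sim x}\theta(\overrightarrow{xy})=0$ for every vertex $x\notin\{0,v\}$ and $\sum_{y\sim 0}\theta(\overrightarrow{0y})=\sum_{y\sim v}\theta(\overrightarrow{yv})$; the common value of these last two sums is its strength $\|\theta\|$. For resistances $r=(r_e)_{e\in E}$ with $r_e>0$, the point-to-point effective resistance is $$\mathcal{R}_r(0\leftrightarrow v)=\inf_{\|\theta\|=1}\ \sum_{e\in E} r_e\,\theta(e)^2 ,$$ the infimum being over all flows $\theta$ from $0$ to $v$ of strength $1$. Let $0<a\le b<+\infty$, let $\nu=\tfrac12\delta_a+\tfrac12\delta_b$, and let $\mu=\nu^{\otimes E}$, so that under $\mu$ the resistances are i.i.d. with law $\nu$. Then for every $v\ne 0$ the random variable $r\mapsto\mathcal{R}_r(0\leftrightarrow v)$ is square integrable under $\mu$, and there are constants $c,C>0$ and $N$, depending only on $a$ and $b$, such that for all $v\in\mathbb{Z}^2$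 with $|v|\ge N$, $$\mathrm{Var}_\mu\big(\mathcal{R}_r(0\leftrightarrow v)\big)\le C\,(\log|v|)^{2/3} \qquad\text{and}\qquad c\log|v|\ \le\ \mathbb{E}_\mu\big(\mathcal{R}_r(0\leftrightarrow v)\big)\ \le\ C\log|v| .$$ -/

import Mathlib

open MeasureTheory ProbabilityTheory

/-- A flow from the vertex `s` to the vertex `t` on a locally finite graph `G`: an antisymmetric
function on the oriented edges (extended by `0` to all ordered pairs of vertices) which satisfies
the node law away from `s` and `t`, and whose flow out of `s` equals its flow into `t`. -/
structure SimpleGraph.ElectricFlow {V : Type*} (G : SimpleGraph V) [G.LocallyFinite]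
    (s t : V) where
  val : V → V → ℝ
  antisymm : ∀ x y, val x y = -val y x
  eq_zero_of_not_adj : ∀ x y, ¬ G.Adj x y → val x y = 0
  node_law : ∀ x, x ≠ s → x ≠ t → ∑ y ∈ G.neighborFinset x, val x y = 0
  balance : ∑ y ∈ G.neighborFinset s, val s y = ∑ y ∈ G.neighborFinset t, val y t

namespace SimpleGraph

variable {V : Type*} {G : SimpleGraph V} [G.LocallyFinite] {s t : V}

/-- The strength of a flow. -/
def ElectricFlow.strength (θ : G.ElectricFlow s t) : ℝ :=
  ∑ y ∈ G.neighborFinset s, θ.val s y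

/-- The square `θ(e)²`, which does not depend on the orientation of the edge `e`. -/
def ElectricFlow.sq (θ : G.ElectricFlow s t) : Sym2 V → ℝ :=
  Sym2.lift ⟨fun x y => θ.val x y ^ 2, fun x y => by
    show θ.val x y ^ 2 = θ.val y x ^ 2
    rw [θ.antisymm x y, neg_sq]⟩

end SimpleGraph

/-- The point-to-point effective resistance: the infimum of the energies `∑ₑ rₑ θ(e)²` of the flows
`θ` from `s` to `t` of strength `1`. Flows of infinite energy do not contribute to the infimum. -/
noncomputable def SimpleGraph.effectiveResistance {V : Type*} (G : SimpleGraph V)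
    [G.LocallyFinite] (r : G.edgeSet → ℝ) (s t : V) : ℝ :=
  sInf {x : ℝ | ∃ θ : G.ElectricFlow s t, θ.strength = 1 ∧
    HasSum (fun e : G.edgeSet => r e * θ.sq e) x}

/-- The `ℓ¹` norm on `ℤ²`. -/
def l1Norm (v : ℤ × ℤ) : ℕ := v.1.natAbs + v.2.natAbs

/-- The nearest-neighbour graph on `ℤ²`. -/
def squareLattice : SimpleGraph (ℤ × ℤ) where
  Adj x y := l1Norm (x - y) = 1
  symm := ⟨fun x y h => by simp only [l1Norm, Prod.fst_sub, Prod.snd_sub] at *; omega⟩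
  loopless := ⟨fun x h => by simp [l1Norm] at h⟩

instance squareLattice.locallyFinite : squareLattice.LocallyFinite := fun x =>
  Fintype.ofFinset {(x.1 + 1, x.2), (x.1 - 1, x.2), (x.1, x.2 + 1), (x.1, x.2 - 1)} (by
    rintro ⟨y₁, y₂⟩
    obtain ⟨x₁, x₂⟩ := x
    simp only [Finset.mem_insert, Finset.mem_singleton, Prod.mk.injEq,
      SimpleGraph.mem_neighborSet, squareLattice, l1Norm, Prod.fst_sub, Prod.snd_sub]
    omega)

/-- The law `½ δ_a + ½ δ_b` on `ℝ`. -/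
noncomputable def bernoulliLaw (a b : ℝ) : Measure ℝ :=
  (2⁻¹ : ENNReal) • Measure.dirac a + (2⁻¹ : ENNReal) • Measure.dirac b

instance bernoulliLaw.isProbabilityMeasure (a b : ℝ) :
    IsProbabilityMeasure (bernoulliLaw a b) :=
  ⟨by simp [bernoulliLaw, ENNReal.inv_two_add_inv_two]⟩

/-- The law of i.i.d. resistances on the edges of `ℤ²` with marginal `½ δ_a + ½ δ_b`. -/
noncomputable def resistanceLaw (a b : ℝ) : Measure (squareLattice.edgeSet → ℝ) :=
  Measure.infinitePi fun _ => bernoulliLaw a b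

/-! The resistance is `u 0 - u v`, where `u` is the potential of the unit current from `0` to `v` in
the network with conductances `1 / r`. Everything rests on deterministic bounds for `u` that use
only the uniform ellipticity of the conductances. The mean: a function of finite energy oscillates
at distance `n` by at most a constant times the root of its energy times `log n`, and the energy of
`u` is the resistance itself, so the resistance is at most of order `log |v|`
(`IsPotential.sub_le_log`). A logarithmic cutoff, whose energy is of order `1 / log |v|`, gives the
matching lower bound (`IsPotential.log_le_sub`). The variance: the optimal flow stays admissible
when the resistance of one edge `e` is flipped, so the flip raises the effective resistance by at
most `(b - a) θ(e)²`. Efron–Stein then bounds the variance by a multiple of the expectation of `∑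
θ(e)⁴`, and `IsPotential.sum_grad_pow_four_le` bounds that sum by order `√(log |v|)`, stronger than
the exponent `2/3` that is claimed. For the fourth powers, fix a radius `n`. The edges within `n` of
the source or sink carry energy `O(log n)`, and the gradient is bounded. At the other edges the
squared gradient is `O(1 / log n)`: by reciprocity it is the squared difference, between source and
sink, of the dipole potential across the edge, and a Courant–Lebesgue argument with the maximum
principle makes that difference small. The total energy is `O(log |v|)`, so the sum is `O(log n +
log |v| / log n)`, and `log n ≈ √(log |v|)` balances the two terms. Two limits remain. Recurrence of
`ℤ²`, through the same cutoffs, identifies the infimum over all finite-energy flows with the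
potential difference (`effectiveResistance_eq`). Efron–Stein is proved for finitely many random
edges and extended by dominated convergence. -/

namespace LatticeNetwork

/-! ### Finite-energy functions and existence of potentials -/

/-- The unit step in one of the two coordinate directions. -/
def unitStep : Bool → ℤ × ℤ
  | false => (1, 0)
  | true => (0, 1)

/-- The edges of `ℤ²`, oriented in the positive coordinate directions: the pair `(x, i)` stands for
the edge from `x` to `x + unitStep i`. -/
abbrev OrientedEdge := (ℤ × ℤ) × Bool

/-- The discrete gradient. -/
def grad (f : ℤ × ℤ → ℝ) (d : OrientedEdge) : ℝ := f (d.1 + unitStep d.2) - f d.1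

/-- Functions whose gradient is square summable. -/
def FiniteEnergy (f : ℤ × ℤ → ℝ) : Prop := Summable fun d => grad f d ^ 2

/-- The Dirichlet form with conductances `c`. -/
noncomputable def dirichletForm (c : OrientedEdge → ℝ) (f g : ℤ × ℤ → ℝ) : ℝ :=
  ∑' d, c d * grad f d * grad g d

/-- The conductances `c` take values in the interval `[m, M]`, with `0 < m`. -/
structure Elliptic (m M : ℝ) (c : OrientedEdge → ℝ) : Prop where
  pos : 0 < m
  lower : ∀ d, m ≤ c d
  upper : ∀ d, c d ≤ M

variable {m M : ℝ} {c : OrientedEdge → ℝ}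

lemma Elliptic.pos_apply (hc : Elliptic m M c) (d : OrientedEdge) : 0 < c d :=
  hc.pos.trans_le (hc.lower d)

lemma summable_mul_of_sq {ι : Type*} {f g : ι → ℝ} (hf : Summable fun i => f i ^ 2)
    (hg : Summable fun i => g i ^ 2) : Summable fun i => f i * g i := by
  refine Summable.of_norm_bounded (hf.add hg) fun i => ?_
  rw [Real.norm_eq_abs, abs_le]
  constructor <;> nlinarith [sq_nonneg (f i + g i), sq_nonneg (f i - g i)]

lemma tsum_mul_sq_le {ι : Type*} {f g : ι → ℝ} (hf : Summable fun i => f i ^ 2)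
    (hg : Summable fun i => g i ^ 2) :
    (∑' i, f i * g i) ^ 2 ≤ (∑' i, f i ^ 2) * ∑' i, g i ^ 2 := by
  have hfg := summable_mul_of_sq hf hg
  refine le_of_tendsto_of_tendsto (Filter.Tendsto.pow hfg.hasSum 2) (Filter.Tendsto.mul hf.hasSum hg.hasSum)
    (Filter.Eventually.of_forall fun s => ?_)
  exact Finset.sum_mul_sq_le_sq_mul_sq s f g

lemma Elliptic.summable (hc : Elliptic m M c) {f g : ℤ × ℤ → ℝ} (hf : FiniteEnergy f)
    (hg : FiniteEnergy g) : Summable fun d => c d * grad f d * grad g d := by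
  refine Summable.of_norm_bounded ((hf.add hg).mul_left M) fun d => ?_
  have h1 := hc.upper d
  have h0 := hc.pos_apply d
  have h2 : |grad f d * grad g d| ≤ grad f d ^ 2 + grad g d ^ 2 := by
    rw [abs_le]
    constructor <;> nlinarith [sq_nonneg (grad f d + grad g d), sq_nonneg (grad f d - grad g d)]
  rw [Real.norm_eq_abs, mul_assoc, abs_mul, abs_of_pos h0]
  exact mul_le_mul h1 h2 (abs_nonneg _) (h0.le.trans h1)

lemma dirichletForm_comm (c : OrientedEdge → ℝ) (f g : ℤ × ℤ → ℝ) :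
    dirichletForm c f g = dirichletForm c g f :=
  tsum_congr fun d => by ring

lemma Elliptic.energy_le (hc : Elliptic m M c) {f : ℤ × ℤ → ℝ} (hf : FiniteEnergy f) :
    m * ∑' d, grad f d ^ 2 ≤ dirichletForm c f f := by
  rw [← tsum_mul_left]
  refine Summable.tsum_le_tsum (fun d => ?_) (hf.mul_left m) (hc.summable hf hf)
  nlinarith [hc.lower d, sq_nonneg (grad f d)]

lemma Elliptic.le_energy (hc : Elliptic m M c) {f : ℤ × ℤ → ℝ} (hf : FiniteEnergy f) :
    dirichletForm c f f ≤ M * ∑' d, grad f d ^ 2 := by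
  rw [← tsum_mul_left]
  refine Summable.tsum_le_tsum (fun d => ?_) (hc.summable hf hf) (hf.mul_left M)
  nlinarith [hc.upper d, sq_nonneg (grad f d)]

lemma Elliptic.form_sq_le (hc : Elliptic m M c) {f g : ℤ × ℤ → ℝ} (hf : FiniteEnergy f)
    (hg : FiniteEnergy g) :
    dirichletForm c f g ^ 2 ≤ dirichletForm c f f * dirichletForm c g g := by
  have key : ∀ h k : ℤ × ℤ → ℝ, ∀ d, (√(c d) * grad h d) * (√(c d) * grad k d) =
      c d * grad h d * grad k d := fun h k d => by
    have := Real.mul_self_sqrt (hc.pos_apply d).le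
    linear_combination grad h d * grad k d * this
  have hs : ∀ h, FiniteEnergy h → Summable fun d => (√(c d) * grad h d) ^ 2 := fun h hh => by
    simpa only [sq, key] using hc.summable hh hh
  simpa only [sq (√ _ * _), key, dirichletForm] using tsum_mul_sq_le (hs f hf) (hs g hg)

/-- Induction along the edges of the lattice. -/
lemma lattice_induction {P : ℤ × ℤ → Prop} (h0 : P 0)
    (hstep : ∀ d : OrientedEdge, P d.1 ↔ P (d.1 + unitStep d.2)) (x : ℤ × ℤ) : P x := by
  have hx : ∀ p : ℤ, P (p, 0) := fun p => by
    induction p using Int.induction_on with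
    | zero => exact h0
    | succ k ih => simpa [unitStep] using (hstep ((k, 0), false)).1 ih
    | pred k ih => exact (hstep ((-k - 1, 0), false)).2 (by simpa [unitStep] using ih)
  obtain ⟨p, q⟩ := x
  induction q using Int.induction_on with
  | zero => exact hx p
  | succ k ih => simpa [unitStep] using (hstep ((p, k), true)).1 ih
  | pred k ih => exact (hstep ((p, -k - 1), true)).2 (by simpa [unitStep] using ih)

lemma eq_of_grad_eq_zero {f : ℤ × ℤ → ℝ} (hf : ∀ d, grad f d = 0) (x y : ℤ × ℤ) : f x = f y := by
  have h : ∀ x, f x = f 0 := fun x =>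
    lattice_induction (P := fun x => f x = f 0) rfl (fun d => by
      have := hf d
      rw [grad, sub_eq_zero] at this
      rw [this]) x
  rw [h x, h y]

lemma tsum_grad_sq_nonneg (f : ℤ × ℤ → ℝ) : 0 ≤ ∑' d, grad f d ^ 2 :=
  tsum_nonneg fun _ => sq_nonneg _

/-- A finite-energy function as an element of `ℓ²`, weighted by the conductances. -/
noncomputable def weightedGrad (hc : Elliptic m M c) (f : ℤ × ℤ → ℝ) (hf : FiniteEnergy f) :
    lp (fun _ : OrientedEdge => ℝ) 2 :=
  ⟨fun d => √(c d) * grad f d, by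
    refine memℓp_gen ?_
    have : ∀ d, c d * grad f d * grad f d = (√(c d) * grad f d) ^ 2 := fun d => by
      rw [mul_pow, Real.sq_sqrt (hc.pos_apply d).le]; ring
    simpa [this, sq_abs, ← abs_mul] using hc.summable hf hf⟩

lemma inner_weightedGrad (hc : Elliptic m M c) {f g : ℤ × ℤ → ℝ} (hf : FiniteEnergy f)
    (hg : FiniteEnergy g) :
    inner ℝ (weightedGrad hc f hf) (weightedGrad hc g hg) = dirichletForm c f g := by
  rw [lp.inner_eq_tsum]
  refine tsum_congr fun d => ?_
  have := Real.mul_self_sqrt (hc.pos_apply d).le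
  simp only [weightedGrad, RCLike.inner_apply, conj_trivial]
  linear_combination grad f d * grad g d * this

/-- A path from `0` to `x` has finitely many edges, and each increment along it is one coordinate of
the weighted gradient divided by `√(c d)`, hence a bounded functional. -/
lemma exists_evaluation (hc : Elliptic m M c) (x : ℤ × ℤ) :
    ∃ p : lp (fun _ : OrientedEdge => ℝ) 2, ∀ f (hf : FiniteEnergy f),
      inner ℝ p (weightedGrad hc f hf) = f x - f 0 := by
  have hs : ∀ d : OrientedEdge, ∃ p : lp (fun _ : OrientedEdge => ℝ) 2,
      ∀ f (hf : FiniteEnergy f), inner ℝ p (weightedGrad hc f hf) = grad f d := fun d => by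
    refine ⟨lp.single 2 d (√(c d))⁻¹, fun f hf => ?_⟩
    have h := Real.sqrt_pos.2 (hc.pos_apply d)
    rw [lp.inner_single_left]
    simp only [weightedGrad, RCLike.inner_apply, conj_trivial]
    field_simp
  refine lattice_induction (P := fun x => ∃ p : lp (fun _ : OrientedEdge => ℝ) 2,
    ∀ f (hf : FiniteEnergy f), inner ℝ p (weightedGrad hc f hf) = f x - f 0)
    ⟨0, fun f hf => by simp⟩ (fun d => ?_) x
  obtain ⟨q, hq⟩ := hs d
  constructor
  · rintro ⟨p, hp⟩
    exact ⟨p + q, fun f hf => by rw [inner_add_left, hp, hq, grad]; ring⟩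
  · rintro ⟨p, hp⟩
    exact ⟨p - q, fun f hf => by rw [inner_sub_left, hp, hq, grad]; ring⟩

lemma FiniteEnergy.add {f g : ℤ × ℤ → ℝ} (hf : FiniteEnergy f) (hg : FiniteEnergy g) :
    FiniteEnergy (f + g) := by
  refine Summable.of_nonneg_of_le (fun _ => sq_nonneg _) (fun d => ?_)
    ((Summable.add hf hg).mul_left 2)
  have : grad (f + g) d = grad f d + grad g d := by simp only [grad, Pi.add_apply]; ring
  rw [this]
  nlinarith [sq_nonneg (grad f d - grad g d)]

lemma FiniteEnergy.smul {f : ℤ × ℤ → ℝ} (hf : FiniteEnergy f) (a : ℝ) : FiniteEnergy (a • f) := by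
  have : ∀ d, grad (a • f) d ^ 2 = a ^ 2 * grad f d ^ 2 := fun d => by
    simp only [grad, Pi.smul_apply, smul_eq_mul]; ring
  simpa only [FiniteEnergy, this] using Summable.mul_left (a ^ 2) hf

/-- The weighted gradients form a subspace of `ℓ²`. -/
noncomputable def gradientSpace (hc : Elliptic m M c) :
    Submodule ℝ (lp (fun _ : OrientedEdge => ℝ) 2) where
  carrier := {g | ∃ f, ∃ hf : FiniteEnergy f, weightedGrad hc f hf = g}
  zero_mem' := by
    refine ⟨0, by simp [FiniteEnergy, grad, summable_zero], ?_⟩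
    ext d
    simp [weightedGrad, grad]
  add_mem' := by
    rintro _ _ ⟨f, hf, rfl⟩ ⟨g, hg, rfl⟩
    refine ⟨f + g, hf.add hg, ?_⟩
    ext d
    simp only [weightedGrad, grad, Pi.add_apply, lp.coeFn_add]
    ring
  smul_mem' := by
    rintro a _ ⟨f, hf, rfl⟩
    refine ⟨a • f, hf.smul a, ?_⟩
    ext d
    simp only [weightedGrad, grad, Pi.smul_apply, smul_eq_mul, lp.coeFn_smul]
    ring

/-- Normalised to vanish at `0`, the functions converge pointwise because evaluations are continuous
in `ℓ²`; the pointwise limit has the limiting gradient. -/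
lemma isClosed_gradientSpace (hc : Elliptic m M c) :
    IsClosed (gradientSpace hc : Set (lp (fun _ : OrientedEdge => ℝ) 2)) := by
  refine IsSeqClosed.isClosed fun g l hg hl => ?_
  choose f hf hfg using hg
  choose p hp using exists_evaluation hc
  have hlim : ∀ x, Filter.Tendsto (fun n => f n x - f n 0) Filter.atTop
      (nhds (inner ℝ (p x) l)) := fun x => by
    have h : Filter.Tendsto (fun n => (inner ℝ (p x) (g n) : ℝ)) Filter.atTop
        (nhds (inner ℝ (p x) l)) := tendsto_const_nhds.inner hl
    simpa only [← hfg, hp] using h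
  have hgrad : ∀ d, √(c d) * grad (fun x => inner ℝ (p x) l) d = l d := fun d => by
    have h1 : Filter.Tendsto (fun n => √(c d) * grad (f n) d) Filter.atTop
        (nhds (√(c d) * grad (fun x => inner ℝ (p x) l) d)) := by
      refine (((hlim (d.1 + unitStep d.2)).sub (hlim d.1)).const_mul √(c d)).congr fun n => ?_
      rw [grad]; ring
    have h2 : Filter.Tendsto (fun n => √(c d) * grad (f n) d) Filter.atTop (nhds (l d)) := by
      have : Filter.Tendsto (fun n => g n d) Filter.atTop (nhds (l d)) := by
        rw [tendsto_iff_norm_sub_tendsto_zero] at hl ⊢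
        refine squeeze_zero (fun _ => norm_nonneg _) (fun n => ?_) hl
        exact lp.norm_apply_le_norm (by norm_num) (g n - l) d
      refine this.congr fun n => ?_
      rw [← hfg n]; rfl
    exact tendsto_nhds_unique h1 h2
  have hfin : FiniteEnergy fun x => inner ℝ (p x) l := by
    have hl2 : Summable fun d => l d ^ 2 := by
      simpa [sq] using lp.summable_inner (𝕜 := ℝ) l l
    refine Summable.of_nonneg_of_le (fun _ => sq_nonneg _) (fun d => ?_) (hl2.mul_left m⁻¹)
    rw [← hgrad d, mul_pow, Real.sq_sqrt (hc.pos_apply d).le, ← mul_assoc]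
    refine le_mul_of_one_le_left (sq_nonneg _) ?_
    rw [inv_mul_eq_div, one_le_div hc.pos]
    exact hc.lower d
  exact ⟨_, hfin, by ext d; exact hgrad d⟩

/-- `u` is the potential of the unit current flow from `x` to `y`. -/
structure IsPotential (c : OrientedEdge → ℝ) (x y : ℤ × ℤ) (u : ℤ × ℤ → ℝ) : Prop where
  finiteEnergy : FiniteEnergy u
  form_eq : ∀ f, FiniteEnergy f → dirichletForm c u f = f x - f y

/-- Riesz representation of `f ↦ f x - f y` on the closed space of gradients: project the
representing vector of `ℓ²` onto that space. -/
theorem Elliptic.exists_isPotential (hc : Elliptic m M c) (x y : ℤ × ℤ) :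
    ∃ u, IsPotential c x y u := by
  obtain ⟨p, hp⟩ := exists_evaluation hc x
  obtain ⟨q, hq⟩ := exists_evaluation hc y
  have : CompleteSpace (gradientSpace hc) := (isClosed_gradientSpace hc).completeSpace_coe
  obtain ⟨u, hu, hug⟩ := ((gradientSpace hc).orthogonalProjectionOnto (p - q)).2
  refine ⟨u, hu, fun f hf => ?_⟩
  rw [← inner_weightedGrad hc hu hf, hug]
  have h := Submodule.inner_orthogonalProjectionOnto_eq_of_mem_left
    (K := gradientSpace hc) ⟨weightedGrad hc f hf, f, hf, rfl⟩ (p - q)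
  rw [Submodule.coe_inner] at h
  rw [real_inner_comm, h, real_inner_comm, inner_sub_left, hp, hq]
  ring

end LatticeNetwork

/-! ### Reciprocity, maximum principle and decay of oscillation -/

namespace LatticeNetwork

variable {m M : ℝ} {c : OrientedEdge → ℝ} {x y : ℤ × ℤ} {u : ℤ × ℤ → ℝ}

lemma grad_neg (f : ℤ × ℤ → ℝ) (d : OrientedEdge) : grad (-f) d = -grad f d := by
  simp only [grad, Pi.neg_apply]; ring

lemma FiniteEnergy.neg {f : ℤ × ℤ → ℝ} (hf : FiniteEnergy f) : FiniteEnergy (-f) := by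
  simpa only [FiniteEnergy, grad_neg, neg_sq] using hf

lemma IsPotential.neg (hu : IsPotential c x y u) : IsPotential c y x (-u) := by
  refine ⟨hu.finiteEnergy.neg, fun f hf => ?_⟩
  rw [← neg_sub, ← hu.form_eq f hf, dirichletForm, dirichletForm, ← tsum_neg]
  exact tsum_congr fun d => by rw [grad_neg]; ring

lemma IsPotential.form_self (hu : IsPotential c x y u) : dirichletForm c u u = u x - u y :=
  hu.form_eq u hu.finiteEnergy

/-- Both sides are the Dirichlet form of `u` and `w`. This is how the gradient of `u` at an edge
becomes a difference of the dipole potential of that edge. -/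
lemma IsPotential.reciprocity {z t : ℤ × ℤ} {w : ℤ × ℤ → ℝ} (hu : IsPotential c x y u)
    (hw : IsPotential c z t w) : u z - u t = w x - w y := by
  rw [← hu.form_eq w hw.finiteEnergy, dirichletForm_comm, hw.form_eq u hu.finiteEnergy]

lemma finiteEnergy_of_truncation {f : ℤ × ℤ → ℝ} (hu : FiniteEnergy u)
    (h : ∀ d, grad f d ^ 2 ≤ grad u d * grad f d) : FiniteEnergy f := by
  refine Summable.of_nonneg_of_le (fun _ => sq_nonneg _) (fun d => ?_) hu
  nlinarith [h d, sq_nonneg (grad u d - grad f d)]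

/-- A truncation of a potential which takes no larger value at the source than at the sink is
constant. -/
lemma IsPotential.eq_of_truncation (hc : Elliptic m M c) (hu : IsPotential c x y u)
    {f : ℤ × ℤ → ℝ} (h : ∀ d, grad f d ^ 2 ≤ grad u d * grad f d) (hxy : f x ≤ f y)
    (z w : ℤ × ℤ) : f z = f w := by
  have hf := finiteEnergy_of_truncation hu.finiteEnergy h
  -- The right-hand side equals `f x - f y ≤ 0`, so `f` has no energy.
  have h1 : dirichletForm c f f ≤ dirichletForm c u f := by
    refine Summable.tsum_le_tsum (fun d => ?_) (hc.summable hf hf)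
      (hc.summable hu.finiteEnergy hf)
    nlinarith [h d, hc.pos_apply d]
  have h2 := hc.energy_le hf
  rw [hu.form_eq f hf] at h1
  have h3 : ∑' d, grad f d ^ 2 = 0 := by
    refine le_antisymm ?_ (tsum_grad_sq_nonneg f)
    by_contra hlt
    push Not at hlt
    have := mul_pos hc.pos hlt
    linarith
  have h4 := (hasSum_zero_iff_of_nonneg fun d => sq_nonneg (grad f d)).1 (h3 ▸ hf.hasSum)
  exact eq_of_grad_eq_zero (fun d => by simpa using congrFun h4 d) z w

lemma max_zero_sub_sq_le (p q : ℝ) :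
    (max p 0 - max q 0) ^ 2 ≤ (p - q) * (max p 0 - max q 0) := by
  rcases max_cases p 0 with ⟨h1, h2⟩ | ⟨h1, h2⟩ <;> rcases max_cases q 0 with ⟨h3, h4⟩ | ⟨h3, h4⟩ <;>
    rw [h1, h3] <;> nlinarith

lemma IsPotential.sink_le_source (hc : Elliptic m M c) (hu : IsPotential c x y u) : u y ≤ u x := by
  have h := hc.energy_le hu.finiteEnergy
  rw [hu.form_self] at h
  have := mul_nonneg hc.pos.le (tsum_grad_sq_nonneg u)
  linarith

/-- The excess of `u` over the level `u x` vanishes at both source and sink, so as a truncation it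
is constant. -/
lemma IsPotential.le_source (hc : Elliptic m M c) (hu : IsPotential c x y u) (z : ℤ × ℤ) :
    u z ≤ u x := by
  have hxy := hu.sink_le_source hc
  have h := hu.eq_of_truncation hc (f := fun z => max (u z - u x) 0) (fun d => by
    have := max_zero_sub_sq_le (u (d.1 + unitStep d.2) - u x) (u d.1 - u x)
    simpa [grad] using this) (by simp [hxy]) z x
  simp only [sub_self, max_self, max_eq_right_iff] at h
  linarith

lemma IsPotential.sink_le (hc : Elliptic m M c) (hu : IsPotential c x y u) (z : ℤ × ℤ) :
    u y ≤ u z := by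
  simpa using hu.neg.le_source hc z

/-- The supremum norm on `ℤ²`. -/
def boxNorm (z : ℤ × ℤ) : ℕ := max z.1.natAbs z.2.natAbs

lemma boxNorm_add_unitStep_le (z : ℤ × ℤ) (i : Bool) :
    boxNorm (z + unitStep i) ≤ boxNorm z + 1 ∧ boxNorm z ≤ boxNorm (z + unitStep i) + 1 := by
  cases i <;> simp only [boxNorm, unitStep, Prod.fst_add, Prod.snd_add] <;> omega

/-- The maximum principle outside a box which contains the source and the sink. -/
lemma IsPotential.le_of_boundary_le (hc : Elliptic m M c) (hu : IsPotential c x y u)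
    (o : ℤ × ℤ) {j : ℕ} (hx : boxNorm (x - o) ≤ j) (hy : boxNorm (y - o) ≤ j) {B : ℝ}
    (hB : ∀ z, boxNorm (z - o) = j → u z ≤ B) {z : ℤ × ℤ} (hz : j < boxNorm (z - o)) :
    u z ≤ B := by
  classical
  -- The positive part of `u - B`, extended by zero into the box, is still a truncation: an edge
  -- leaving the box starts at radius exactly `j`, where `u ≤ B`.
  have h := hu.eq_of_truncation hc
    (f := fun z => if j < boxNorm (z - o) then max (u z - B) 0 else 0) (fun d => by
    have hd := boxNorm_add_unitStep_le (d.1 - o) d.2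
    rw [sub_add_eq_add_sub] at hd
    have hm := max_zero_sub_sq_le (u (d.1 + unitStep d.2) - B) (u d.1 - B)
    simp only [grad]
    by_cases h1 : j < boxNorm (d.1 + unitStep d.2 - o) <;> by_cases h2 : j < boxNorm (d.1 - o)
    · simpa [h1, h2] using hm
    · have := hB d.1 (by omega)
      rw [max_eq_right (by linarith : u d.1 - B ≤ 0)] at hm
      simpa [h1, h2] using hm
    · have := hB (d.1 + unitStep d.2) (by omega)
      rw [max_eq_right (by linarith : u (d.1 + unitStep d.2) - B ≤ 0)] at hm
      simpa [h1, h2] using hm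
    · simp [h1, h2]) (by simp [not_lt.2 hx, not_lt.2 hy]) z x
  simp only [hz, if_true, not_lt.2 hx, if_false, max_eq_right_iff] at h
  linarith

lemma sq_grad_sum_le {f : ℤ × ℤ → ℝ} (hf : FiniteEnergy f) {ι : Type*} (s : Finset ι)
    (φ : ι → OrientedEdge) (hφ : Set.InjOn φ s) :
    ∑ i ∈ s, grad f (φ i) ^ 2 ≤ ∑' d, grad f d ^ 2 := by
  classical
  rw [← Finset.sum_image (f := fun d => grad f d ^ 2) hφ]
  exact hf.sum_le_tsum _ fun _ _ => sq_nonneg _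

lemma abs_sub_le_sum_Ico (h : ℤ → ℝ) {s t : ℤ} (hst : s ≤ t) :
    |h t - h s| ≤ ∑ i ∈ Finset.Ico s t, |h (i + 1) - h i| := by
  induction t, hst using Int.leInduction with
  | base => simp
  | succ n hn ih =>
    rw [← Finset.insert_Ico_right_eq_Ico_add_one hn, Finset.sum_insert (by simp)]
    calc |h (n + 1) - h s| = |(h (n + 1) - h n) + (h n - h s)| := by ring_nf
      _ ≤ _ := (abs_add_le _ _).trans (by gcongr)

lemma sub_sq_le_sum_Ico (h : ℤ → ℝ) (j : ℕ) {s t : ℤ} (hs : s.natAbs ≤ j) (ht : t.natAbs ≤ j) :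
    (h s - h t) ^ 2 ≤ 2 * j * ∑ i ∈ Finset.Ico (-j : ℤ) j, (h (i + 1) - h i) ^ 2 := by
  wlog hst : s ≤ t generalizing s t
  · rw [← neg_sub, neg_sq]
    exact this ht hs (by omega)
  have h1 : |h t - h s| ≤ ∑ i ∈ Finset.Ico (-j : ℤ) j, |h (i + 1) - h i| :=
    (abs_sub_le_sum_Ico h hst).trans (Finset.sum_le_sum_of_subset_of_nonneg
      (Finset.Ico_subset_Ico (by omega) (by omega)) fun _ _ _ => abs_nonneg _)
  have h2 := sq_sum_le_card_mul_sum_sq (s := Finset.Ico (-j : ℤ) j)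
    (f := fun i => |h (i + 1) - h i|)
  have h3 : ((Finset.Ico (-j : ℤ) j).card : ℝ) = 2 * j := by
    rw [Int.card_Ico]
    have : ((j : ℤ) - -j).toNat = 2 * j := by omega
    rw [this]; push_cast; ring
  rw [h3] at h2
  simp only [sq_abs] at h2
  calc (h s - h t) ^ 2 = |h t - h s| ^ 2 := by rw [sq_abs]; ring
    _ ≤ (∑ i ∈ Finset.Ico (-j : ℤ) j, |h (i + 1) - h i|) ^ 2 := by gcongr
    _ ≤ _ := h2

/-- The squared gradients along the boundary of the box of radius `j` about `o`. -/
noncomputable def boundaryEnergy (f : ℤ × ℤ → ℝ) (o : ℤ × ℤ) (j : ℕ) : ℝ :=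
  (∑ i ∈ Finset.Ico (-j : ℤ) j, grad f (o + (i, (j : ℤ)), false) ^ 2
    + ∑ i ∈ Finset.Ico (-j : ℤ) j, grad f (o + (i, -(j : ℤ)), false) ^ 2)
  + (∑ i ∈ Finset.Ico (-j : ℤ) j, grad f (o + ((j : ℤ), i), true) ^ 2
    + ∑ i ∈ Finset.Ico (-j : ℤ) j, grad f (o + (-(j : ℤ), i), true) ^ 2)

/-- For each of the four sides, the edges belonging to different radii are distinct; each side is
charged the whole energy once. -/
lemma sum_boundaryEnergy_le {f : ℤ × ℤ → ℝ} (hf : FiniteEnergy f) (o : ℤ × ℤ) (s : Finset ℕ) :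
    ∑ j ∈ s, boundaryEnergy f o j ≤ 4 * ∑' d, grad f d ^ 2 := by
  have key : ∀ φ : ℕ → ℤ → OrientedEdge,
      (∀ j i j' i', φ j i = φ j' i' → j = j' ∧ i = i') →
      ∑ j ∈ s, ∑ i ∈ Finset.Ico (-j : ℤ) j, grad f (φ j i) ^ 2 ≤ ∑' d, grad f d ^ 2 := by
    intro φ hφ
    rw [Finset.sum_sigma']
    refine sq_grad_sum_le hf _ (fun q : (_ : ℕ) × ℤ => φ q.1 q.2) ?_
    rintro ⟨j, i⟩ - ⟨j', i'⟩ - h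
    obtain ⟨rfl, rfl⟩ := hφ _ _ _ _ h
    rfl
  have h1 := key (fun j i => (o + (i, (j : ℤ)), false)) (by
    intro j i j' i' h; simp at h; omega)
  have h2 := key (fun j i => (o + (i, -(j : ℤ)), false)) (by
    intro j i j' i' h; simp at h; omega)
  have h3 := key (fun j i => (o + ((j : ℤ), i), true)) (by
    intro j i j' i' h; simp at h; omega)
  have h4 := key (fun j i => (o + (-(j : ℤ), i), true)) (by
    intro j i j' i' h; simp at h; omega)
  simp only [boundaryEnergy, Finset.sum_add_distrib]
  linarith

/-- Every boundary point reaches the corner `(j, j)` along at most two sides; Cauchy–Schwarz on each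
side costs its length `2j`, and joining two sides costs a factor `2`. -/
lemma sub_corner_sq_le (f : ℤ × ℤ → ℝ) (o : ℤ × ℤ) (j : ℕ) {z : ℤ × ℤ}
    (hz : boxNorm (z - o) = j) :
    (f z - f (o + ((j : ℤ), (j : ℤ)))) ^ 2 ≤ 4 * j * boundaryEnergy f o j := by
  obtain ⟨⟨p, q⟩, rfl⟩ : ∃ t, z = o + t := ⟨z - o, by abel⟩
  rw [add_sub_cancel_left] at hz
  simp only [boxNorm] at hz
  have hj : (j : ℤ).natAbs ≤ j := by omega
  have hj' : (-(j : ℤ)).natAbs ≤ j := by omega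
  have row : ∀ (t s s' : ℤ), s.natAbs ≤ j → s'.natAbs ≤ j →
      (f (o + (s, t)) - f (o + (s', t))) ^ 2 ≤
        2 * j * ∑ i ∈ Finset.Ico (-j : ℤ) j, grad f (o + (i, t), false) ^ 2 := by
    intro t s s' hs hs'
    have h := sub_sq_le_sum_Ico (fun i => f (o + (i, t))) j hs hs'
    simpa [grad, unitStep, add_assoc] using h
  have col : ∀ (t s s' : ℤ), s.natAbs ≤ j → s'.natAbs ≤ j →
      (f (o + (t, s)) - f (o + (t, s'))) ^ 2 ≤
        2 * j * ∑ i ∈ Finset.Ico (-j : ℤ) j, grad f (o + (t, i), true) ^ 2 := by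
    intro t s s' hs hs'
    have h := sub_sq_le_sum_Ico (fun i => f (o + (t, i))) j hs hs'
    simpa [grad, unitStep, add_assoc] using h
  have nn : ∀ φ : ℤ → OrientedEdge,
      0 ≤ 2 * (j : ℝ) * ∑ i ∈ Finset.Ico (-j : ℤ) j, grad f (φ i) ^ 2 := fun φ => by positivity
  have n1 := nn fun i => (o + (i, (j : ℤ)), false)
  have n2 := nn fun i => (o + (i, -(j : ℤ)), false)
  have n3 := nn fun i => (o + ((j : ℤ), i), true)
  have n4 := nn fun i => (o + (-(j : ℤ), i), true)
  have two : ∀ α β γ : ℝ, (α - γ) ^ 2 ≤ 2 * (α - β) ^ 2 + 2 * (β - γ) ^ 2 := fun α β γ => by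
    nlinarith [sq_nonneg ((α - β) - (β - γ))]
  simp only [boundaryEnergy]
  by_cases h1 : q = j
  · subst h1
    have := row j p j (by omega) hj
    linarith
  by_cases h2 : p = j
  · subst h2
    have := col j q j (by omega) hj
    linarith
  by_cases h3 : q = -j
  · subst h3
    have e1 := row (-j) p j (by omega) hj
    have e2 := col j (-j) j hj' hj
    have e3 := two (f (o + (p, -(j : ℤ)))) (f (o + ((j : ℤ), -(j : ℤ))))
      (f (o + ((j : ℤ), (j : ℤ))))
    linarith
  · have h4 : p = -j := by omega
    subst h4
    have e1 := col (-j) q j (by omega) hj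
    have e2 := row j (-j) j hj' hj
    have e3 := two (f (o + (-(j : ℤ), q))) (f (o + (-(j : ℤ), (j : ℤ))))
      (f (o + ((j : ℤ), (j : ℤ))))
    linarith

lemma IsPotential.abs_sub_corner_le (hc : Elliptic m M c) (hu : IsPotential c x y u)
    (o : ℤ × ℤ) {j : ℕ} (hx : boxNorm (x - o) ≤ j) (hy : boxNorm (y - o) ≤ j) {z : ℤ × ℤ}
    (hz : j < boxNorm (z - o)) :
    |u z - u (o + ((j : ℤ), (j : ℤ)))| ≤ √(4 * j * boundaryEnergy u o j) := by
  have hb : ∀ z, boxNorm (z - o) = j →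
      |u z - u (o + ((j : ℤ), (j : ℤ)))| ≤ √(4 * j * boundaryEnergy u o j) := fun z hz =>
    Real.abs_le_sqrt (sub_corner_sq_le u o j hz)
  have h1 := hu.le_of_boundary_le hc o hx hy (fun z hz => by
    have := (abs_le.1 (hb z hz)).2
    exact sub_le_iff_le_add.1 this) hz
  have h2 := hu.neg.le_of_boundary_le hc o hy hx (B := √(4 * j * boundaryEnergy u o j) -
    u (o + ((j : ℤ), (j : ℤ)))) (fun z hz => by
    have := (abs_le.1 (hb z hz)).1
    simp only [Pi.neg_apply]; linarith) hz
  simp only [Pi.neg_apply] at h2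
  rw [abs_le]
  constructor <;> linarith

/-- The oscillation of a potential far from the source and the sink decays logarithmically. -/
theorem IsPotential.sub_sq_mul_harmonic_le (hc : Elliptic m M c) (hu : IsPotential c x y u)
    (o : ℤ × ℤ) (hx : boxNorm (x - o) ≤ 1) (hy : boxNorm (y - o) ≤ 1) {n : ℕ} {z w : ℤ × ℤ}
    (hz : n < boxNorm (z - o)) (hw : n < boxNorm (w - o)) :
    (u z - u w) ^ 2 * ∑ j ∈ Finset.Icc 1 n, (1 / j : ℝ) ≤ 64 * ∑' d, grad u d ^ 2 := by
  -- The Courant–Lebesgue argument: the oscillation outside the box of radius `j` is governed by its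
  -- boundary, at every scale `j`. Dividing by `j` and summing produces the harmonic sum against the
  -- total energy.
  have h : ∀ j ∈ Finset.Icc 1 n, (u z - u w) ^ 2 * (1 / j : ℝ) ≤ 16 * boundaryEnergy u o j := by
    intro j hj
    rw [Finset.mem_Icc] at hj
    have hj0 : (0 : ℝ) < j := by exact_mod_cast hj.1
    have hnn : 0 ≤ boundaryEnergy u o j := by unfold boundaryEnergy; positivity
    have h1 := hu.abs_sub_corner_le hc o (hx.trans hj.1) (hy.trans hj.1) (hj.2.trans_lt hz)
    have h2 := hu.abs_sub_corner_le hc o (hx.trans hj.1) (hy.trans hj.1) (hj.2.trans_lt hw)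
    have h3 : |u z - u w| ≤ 2 * √(4 * j * boundaryEnergy u o j) := by
      rw [abs_le] at *
      constructor <;> linarith
    have h4 : (u z - u w) ^ 2 ≤ 16 * j * boundaryEnergy u o j := by
      calc (u z - u w) ^ 2 = |u z - u w| ^ 2 := (sq_abs _).symm
        _ ≤ (2 * √(4 * j * boundaryEnergy u o j)) ^ 2 := by gcongr
        _ = _ := by rw [mul_pow, Real.sq_sqrt (by positivity)]; ring
    rw [mul_one_div, div_le_iff₀ hj0]
    linarith
  rw [Finset.mul_sum]
  refine (Finset.sum_le_sum h).trans ?_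
  rw [← Finset.mul_sum]
  linarith [sum_boundaryEnergy_le hu.finiteEnergy o (Finset.Icc 1 n)]

end LatticeNetwork

/-! ### Logarithmic oscillation of finite-energy functions -/

namespace LatticeNetwork

/-- The average of `g` over the `n`-th antidiagonal. -/
noncomputable def antidiagonalAvg (g : ℕ → ℕ → ℝ) (n : ℕ) : ℝ :=
  (∑ p ∈ Finset.HasAntidiagonal.antidiagonal n, g p.1 p.2) / (n + 1)

/-- The squared increments of `g` between the antidiagonals `n` and `n + 1`. -/
noncomputable def antidiagonalEnergy (g : ℕ → ℕ → ℝ) (n : ℕ) : ℝ :=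
  ∑ p ∈ Finset.HasAntidiagonal.antidiagonal n,
    ((g (p.1 + 1) p.2 - g p.1 p.2) ^ 2 + (g p.1 (p.2 + 1) - g p.1 p.2) ^ 2)

/-- A unit flow spreading through the quadrant: `(i, j)` sends `(i + 1) / ((n + 1)(n + 2))` to the
right and `(j + 1) / ((n + 1)(n + 2))` upwards. Each vertex of antidiagonal `n` thus sends `1 / (n +
1)`, and each of antidiagonal `n + 1` receives `1 / (n + 2)`. -/
lemma antidiagonalAvg_sub_succ (g : ℕ → ℕ → ℝ) (n : ℕ) :
    antidiagonalAvg g n - antidiagonalAvg g (n + 1) =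
      ∑ p ∈ Finset.HasAntidiagonal.antidiagonal n, -((p.1 + 1) * (g (p.1 + 1) p.2 - g p.1 p.2) +
        (p.2 + 1) * (g p.1 (p.2 + 1) - g p.1 p.2)) / ((n + 1) * (n + 2)) := by
  have h1 := Finset.Nat.sum_antidiagonal_succ (n := n)
    (f := fun p : ℕ × ℕ => (p.1 : ℝ) * g p.1 p.2)
  have h2 := Finset.Nat.sum_antidiagonal_succ' (n := n)
    (f := fun p : ℕ × ℕ => (p.2 : ℝ) * g p.1 p.2)
  have h3 : ((n : ℝ) + 1) * ∑ p ∈ Finset.HasAntidiagonal.antidiagonal (n + 1), g p.1 p.2 =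
      ∑ p ∈ Finset.HasAntidiagonal.antidiagonal (n + 1), (p.1 : ℝ) * g p.1 p.2 +
      ∑ p ∈ Finset.HasAntidiagonal.antidiagonal (n + 1), (p.2 : ℝ) * g p.1 p.2 := by
    rw [Finset.mul_sum, ← Finset.sum_add_distrib]
    refine Finset.sum_congr rfl fun p hp => ?_
    have : (p.1 : ℝ) + p.2 = n + 1 := by exact_mod_cast Finset.HasAntidiagonal.mem_antidiagonal.1 hp
    rw [← this]; ring
  have h4 : ((n : ℝ) + 2) * ∑ p ∈ Finset.HasAntidiagonal.antidiagonal n, g p.1 p.2 =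
      ∑ p ∈ Finset.HasAntidiagonal.antidiagonal n, ((p.1 + 1 : ℝ) * g p.1 p.2 + (p.2 + 1) * g p.1 p.2) := by
    rw [Finset.mul_sum]
    refine Finset.sum_congr rfl fun p hp => ?_
    have : (p.1 : ℝ) + p.2 = n := by exact_mod_cast Finset.HasAntidiagonal.mem_antidiagonal.1 hp
    rw [← this]; ring
  rw [h1, h2] at h3
  simp only [Nat.cast_zero, zero_mul, zero_add, Nat.cast_add, Nat.cast_one] at h3
  have h5 : antidiagonalAvg g n - antidiagonalAvg g (n + 1) =
      (((n : ℝ) + 2) * ∑ p ∈ Finset.HasAntidiagonal.antidiagonal n, g p.1 p.2 -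
        ((n : ℝ) + 1) * ∑ p ∈ Finset.HasAntidiagonal.antidiagonal (n + 1), g p.1 p.2) / ((n + 1) * (n + 2)) := by
    simp only [antidiagonalAvg]
    have e1 : (n : ℝ) + 1 ≠ 0 := by positivity
    have e2 : (n : ℝ) + 2 ≠ 0 := by positivity
    have e3 : (n : ℝ) + 1 + 1 ≠ 0 := by positivity
    push_cast
    field_simp
    ring
  rw [h5, h3, h4, ← Finset.sum_add_distrib, ← Finset.sum_sub_distrib, Finset.sum_div]
  exact Finset.sum_congr rfl fun p _ => by ring

lemma antidiagonalAvg_sub_succ_sq_le (g : ℕ → ℕ → ℝ) (n : ℕ) :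
    (antidiagonalAvg g n - antidiagonalAvg g (n + 1)) ^ 2 ≤
      ((n + 1 : ℕ) : ℝ)⁻¹ * antidiagonalEnergy g n := by
  rw [antidiagonalAvg_sub_succ]
  refine sq_sum_le_card_mul_sum_sq.trans ?_
  rw [Finset.Nat.card_antidiagonal, antidiagonalEnergy, Finset.mul_sum, Finset.mul_sum]
  refine Finset.sum_le_sum fun p hp => ?_
  have hp' : (p.1 : ℝ) + p.2 = n := by exact_mod_cast Finset.HasAntidiagonal.mem_antidiagonal.1 hp
  set α := g (p.1 + 1) p.2 - g p.1 p.2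
  set β := g p.1 (p.2 + 1) - g p.1 p.2
  have hA : (0 : ℝ) ≤ p.1 := by positivity
  have hB : (0 : ℝ) ≤ p.2 := by positivity
  have h1 : ((p.1 + 1) * α + (p.2 + 1) * β) ^ 2 ≤ ((n : ℝ) + 2) ^ 2 * (α ^ 2 + β ^ 2) := by
    rw [← hp']
    have : 0 ≤ (p.1 : ℝ) * p.2 := by positivity
    nlinarith [sq_nonneg ((p.1 + 1 : ℝ) * β - (p.2 + 1) * α), sq_nonneg α, sq_nonneg β,
      mul_nonneg (by positivity : 0 ≤ 2 * ((p.1 : ℝ) + 1) * (p.2 + 1))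
        (add_nonneg (sq_nonneg α) (sq_nonneg β))]
  rw [div_pow, neg_sq]
  push_cast
  have e1 : (0 : ℝ) < n + 1 := by positivity
  have e2 : (0 : ℝ) < n + 2 := by positivity
  calc ((n : ℝ) + 1) * (((p.1 + 1) * α + (p.2 + 1) * β) ^ 2 / ((n + 1) * (n + 2)) ^ 2)
      ≤ ((n : ℝ) + 1) * (((n : ℝ) + 2) ^ 2 * (α ^ 2 + β ^ 2) / ((n + 1) * (n + 2)) ^ 2) := by
        gcongr
    _ = _ := by field_simp

/-- Telescoping plus Cauchy–Schwarz with weights `1 / (n + 1)`: the spreading flow has energy of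
order `1 / n` at level `n`. -/
lemma sub_antidiagonalAvg_sq_le (g : ℕ → ℕ → ℝ) (N : ℕ) :
    (g 0 0 - antidiagonalAvg g N) ^ 2 ≤
      (harmonic N : ℝ) * ∑ n ∈ Finset.range N, antidiagonalEnergy g n := by
  have h0 : g 0 0 = antidiagonalAvg g 0 := by simp [antidiagonalAvg]
  rw [h0, ← Finset.sum_range_sub', harmonic]
  push_cast
  refine Finset.sum_sq_le_sum_mul_sum_of_sq_le_mul _ (fun n _ => by positivity)
    (fun n _ => ?_) fun n _ => ?_
  · unfold antidiagonalEnergy; positivity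
  · simpa using antidiagonalAvg_sub_succ_sq_le g n

lemma sum_antidiagonalEnergy_le {f : ℤ × ℤ → ℝ} (hf : FiniteEnergy f) (x : ℤ × ℤ) {ε δ : ℤ}
    (hε : ε = 1 ∨ ε = -1) (hδ : δ = 1 ∨ δ = -1) (N : ℕ) :
    ∑ n ∈ Finset.range N, antidiagonalEnergy (fun i j => f (x + (ε * i, δ * j))) n ≤
      2 * ∑' d, grad f d ^ 2 := by
  have key : ∀ (h : ℕ → ℕ → ℝ) (φ : ℕ → ℕ → OrientedEdge),
      (∀ i j i' j', φ i j = φ i' j' → i = i' ∧ j = j') →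
      (∀ i j, h i j ^ 2 = grad f (φ i j) ^ 2) →
      ∑ n ∈ Finset.range N, ∑ p ∈ Finset.HasAntidiagonal.antidiagonal n, h p.1 p.2 ^ 2 ≤
        ∑' d, grad f d ^ 2 := by
    intro h φ hφ hh
    simp only [hh]
    rw [Finset.sum_sigma']
    refine sq_grad_sum_le hf _ (fun q : (_ : ℕ) × (ℕ × ℕ) => φ q.2.1 q.2.2) ?_
    rintro ⟨n, i, j⟩ h1 ⟨n', i', j'⟩ h2 h
    obtain ⟨rfl, rfl⟩ := hφ _ _ _ _ h
    simp only [Finset.coe_sigma, Set.mem_sigma_iff, SetLike.mem_coe,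
      Finset.HasAntidiagonal.mem_antidiagonal] at h1 h2
    obtain rfl : n = n' := by omega
    rfl
  have hδ' : ∀ j j' : ℕ, δ * (j : ℤ) = δ * j' → j = j' := by rcases hδ with rfl | rfl <;> omega
  have hε' : ∀ j j' : ℕ, ε * (j : ℤ) = ε * j' → j = j' := by rcases hε with rfl | rfl <;> omega
  obtain ⟨φ, hφ, hφ'⟩ : ∃ φ : ℕ → ℕ → OrientedEdge,
      (∀ i j i' j', φ i j = φ i' j' → i = i' ∧ j = j') ∧
      ∀ i j : ℕ, (f (x + (ε * ((i + 1 : ℕ) : ℤ), δ * (j : ℤ))) -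
        f (x + (ε * (i : ℤ), δ * (j : ℤ)))) ^ 2 = grad f (φ i j) ^ 2 := by
    rcases hε with rfl | rfl
    · refine ⟨fun i j => (x + ((i : ℤ), δ * j), false), fun i j i' j' h => ?_, fun i j => ?_⟩
      · simp only [Prod.mk.injEq, add_right_inj, and_true] at h
        exact ⟨by omega, hδ' _ _ h.2⟩
      · simp [grad, unitStep, add_assoc]
    · refine ⟨fun i j => (x + (-(i : ℤ) - 1, δ * j), false), fun i j i' j' h => ?_, fun i j => ?_⟩
      · simp only [Prod.mk.injEq, add_right_inj, and_true] at h
        exact ⟨by omega, hδ' _ _ h.2⟩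
      · rw [← neg_sq, neg_sub, grad, unitStep, add_assoc]
        congr 6 <;> push_cast <;> simp <;> ring
  obtain ⟨ψ, hψ, hψ'⟩ : ∃ φ : ℕ → ℕ → OrientedEdge,
      (∀ i j i' j', φ i j = φ i' j' → i = i' ∧ j = j') ∧
      ∀ i j : ℕ, (f (x + (ε * (i : ℤ), δ * ((j + 1 : ℕ) : ℤ))) -
        f (x + (ε * (i : ℤ), δ * (j : ℤ)))) ^ 2 = grad f (φ i j) ^ 2 := by
    rcases hδ with rfl | rfl
    · refine ⟨fun i j => (x + (ε * i, (j : ℤ)), true), fun i j i' j' h => ?_, fun i j => ?_⟩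
      · simp only [Prod.mk.injEq, add_right_inj, and_true] at h
        exact ⟨hε' _ _ h.1, by omega⟩
      · simp [grad, unitStep, add_assoc]
    · refine ⟨fun i j => (x + (ε * i, -(j : ℤ) - 1), true), fun i j i' j' h => ?_, fun i j => ?_⟩
      · simp only [Prod.mk.injEq, add_right_inj, and_true] at h
        exact ⟨hε' _ _ h.1, by omega⟩
      · rw [← neg_sq, neg_sub, grad, unitStep, add_assoc]
        congr 6 <;> push_cast <;> simp <;> ring
  have h1 := key _ φ hφ hφ'
  have h2 := key _ ψ hψ hψ'
  simp only [antidiagonalEnergy, Finset.sum_add_distrib]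
  linarith

/-- The two ends of a diagonal segment see the same `N`-th antidiagonal, from opposite quadrants, so
both values are compared with one common average. -/
lemma sub_diagonal_sq_le {f : ℤ × ℤ → ℝ} (hf : FiniteEnergy f) (x : ℤ × ℤ) {ε δ : ℤ}
    (hε : ε = 1 ∨ ε = -1) (hδ : δ = 1 ∨ δ = -1) (N : ℕ) :
    (f x - f (x + (ε * N, δ * N))) ^ 2 ≤ 8 * harmonic N * ∑' d, grad f d ^ 2 := by
  set y := x + (ε * N, δ * N) with hy
  have hH : (0 : ℝ) ≤ harmonic N := by
    rw [harmonic]; push_cast; positivity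
  have h1 := sub_antidiagonalAvg_sq_le (fun i j => f (x + (ε * i, δ * j))) N
  have h2 := sub_antidiagonalAvg_sq_le (fun i j => f (y + (-ε * i, -δ * j))) N
  have h3 := sum_antidiagonalEnergy_le hf x hε hδ N
  have h4 := sum_antidiagonalEnergy_le hf y (ε := -ε) (δ := -δ) (by omega) (by omega) N
  have h5 : antidiagonalAvg (fun i j => f (x + (ε * i, δ * j))) N =
      antidiagonalAvg (fun i j => f (y + (-ε * i, -δ * j))) N := by
    simp only [antidiagonalAvg]
    rw [← Finset.Nat.sum_antidiagonal_swap]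
    congr 1
    refine Finset.sum_congr rfl fun p hp => ?_
    have : (N : ℤ) = p.1 + p.2 := by exact_mod_cast (Finset.HasAntidiagonal.mem_antidiagonal.1 hp).symm
    rw [hy, this, add_assoc]
    simp only [Prod.fst_swap, Prod.snd_swap, Prod.mk_add_mk]
    congr 3 <;> ring
  rw [← h5] at h2
  simp only [Nat.cast_zero, mul_zero, Prod.mk_zero_zero, add_zero] at h1 h2
  have h6 := h1.trans (mul_le_mul_of_nonneg_left h3 hH)
  have h7 := h2.trans (mul_le_mul_of_nonneg_left h4 hH)
  set A := antidiagonalAvg (fun i j => f (x + (ε * i, δ * j))) N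
  nlinarith [sq_nonneg ((f x - A) + (f y - A))]

lemma harmonic_le_of_le {N n : ℕ} (h : N ≤ n + 1) : (harmonic N : ℝ) ≤ 1 + Real.log (1 + n) := by
  rcases Nat.eq_zero_or_pos N with rfl | hN
  · have : 0 ≤ Real.log (1 + n) := Real.log_nonneg (by linarith [(Nat.cast_nonneg n : (0:ℝ) ≤ n)])
    simp only [harmonic_zero, Rat.cast_zero]; linarith
  · refine (harmonic_le_one_add_log N).trans ?_
    gcongr
    have : (N : ℝ) ≤ n + 1 := by exact_mod_cast h
    linarith

/-- A finite-energy function oscillates at most like the square root of the logarithm of the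
distance. -/
theorem sub_sq_le_log {f : ℤ × ℤ → ℝ} (hf : FiniteEnergy f) (x y : ℤ × ℤ) :
    (f x - f y) ^ 2 ≤ 66 * (1 + Real.log (1 + l1Norm (y - x))) * ∑' d, grad f d ^ 2 := by
  obtain ⟨⟨p, q⟩, rfl⟩ : ∃ t, y = x + t := ⟨y - x, by abel⟩
  rw [add_sub_cancel_left]
  set n := l1Norm (p, q) with hn
  have hn' : n = p.natAbs + q.natAbs := rfl
  set S := ∑' d, grad f d ^ 2
  have hS : 0 ≤ S := tsum_grad_sq_nonneg f
  set L := 1 + Real.log (1 + n)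
  have hL : 1 ≤ L := by
    have : 0 ≤ Real.log (1 + n) := Real.log_nonneg (by linarith [(Nat.cast_nonneg n : (0:ℝ) ≤ n)])
    linarith
  have hLS : 0 ≤ L * S := by positivity
  have diag : ∀ (z : ℤ × ℤ) (s δ : ℤ), (δ = 1 ∨ δ = -1) → s.natAbs ≤ n + 1 →
      (f z - f (z + (s, δ * s))) ^ 2 ≤ 8 * (L * S) := by
    intro z s δ hδ hs
    have hH := harmonic_le_of_le hs
    have hb : 8 * harmonic s.natAbs * S ≤ 8 * (L * S) := by
      rw [mul_assoc]; gcongr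
    refine le_trans ?_ hb
    rcases Int.natAbs_eq s with h | h
    · have := sub_diagonal_sq_le hf z (Or.inl rfl : (1 : ℤ) = 1 ∨ (1 : ℤ) = -1) hδ s.natAbs
      rwa [one_mul, ← h] at this
    · have := sub_diagonal_sq_le hf z (ε := -1) (δ := -δ) (Or.inr rfl) (by omega) s.natAbs
      rwa [neg_mul_comm δ, neg_one_mul, ← h] at this
  -- Two diagonal moves reach every displacement of even coordinate sum. An odd one needs one
  -- further edge, whence `66 = 2 * 32 + 2`.
  have even : ∀ (z : ℤ × ℤ) (s t : ℤ), s.natAbs ≤ n + 1 → t.natAbs ≤ n + 1 →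
      (f z - f (z + (s + t, s - t))) ^ 2 ≤ 32 * (L * S) := by
    intro z s t hs ht
    have h1 := diag z s 1 (Or.inl rfl) hs
    have h2 := diag (z + (s, 1 * s)) t (-1) (Or.inr rfl) ht
    rw [show z + (s + t, s - t) = z + (s, 1 * s) + (t, -1 * t) by
      ext <;> simp <;> ring]
    set α := f z
    set β := f (z + (s, 1 * s))
    set γ := f (z + (s, 1 * s) + (t, -1 * t))
    nlinarith [sq_nonneg ((α - β) - (β - γ))]
  rcases Int.even_or_odd' (p + q) with ⟨s, hs | hs⟩
  · have h := even x s (p - s) (by omega) (by omega)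
    rw [show (s + (p - s), s - (p - s)) = (p, q) by ext <;> simp; omega] at h
    nlinarith
  · have h := even (x + (1, 0)) s (p - 1 - s) (by omega) (by omega)
    rw [show x + (1, 0) + (s + (p - 1 - s), s - (p - 1 - s)) = x + (p, q) by
      ext
      · simp
      · simp; omega] at h
    have h1 : (f (x + (1, 0)) - f x) ^ 2 ≤ S :=
      hf.le_tsum (x, false) fun _ _ => sq_nonneg _
    set α := f x
    set β := f (x + (1, 0))
    set γ := f (x + (p, q))
    nlinarith [sq_nonneg ((α - β) - (β - γ))]

end LatticeNetwork

/-! ### Logarithmic cutoffs -/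

namespace LatticeNetwork

lemma sum_Icc_natAbs_le {g : ℕ → ℝ} (hg : ∀ k, 0 ≤ g k) (n : ℕ) :
    ∑ z ∈ Finset.Icc (-n : ℤ) n, g z.natAbs ≤ 2 * ∑ k ∈ Finset.range (n + 1), g k := by
  induction n with
  | zero => simpa using by linarith [hg 0]
  | succ n ih =>
    have h : Finset.Icc (-(n + 1 : ℕ) : ℤ) (n + 1 : ℕ) =
        insert (-(n + 1 : ℕ) : ℤ) (insert ((n + 1 : ℕ) : ℤ) (Finset.Icc (-n : ℤ) n)) := by
      ext z
      simp only [Finset.mem_Icc, Finset.mem_insert]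
      omega
    rw [h, Finset.sum_insert (by simp; omega), Finset.sum_insert (by simp),
      Finset.sum_range_succ, Int.natAbs_neg, Int.natAbs_natCast]
    linarith

lemma sum_inv_sq_le (p n : ℕ) :
    ∑ q ∈ Finset.range n, ((1 + p + q : ℝ) ^ 2)⁻¹ ≤ 2 / (1 + p) := by
  -- The inverse squares are dominated by the increments of a telescoping sum; the subtracted term
  -- makes the induction close.
  have h : ∀ n : ℕ, ∑ q ∈ Finset.range n, ((1 + p + q : ℝ) ^ 2)⁻¹ ≤
      2 / (1 + p) - 2 / (1 + p + n) := by
    intro n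
    induction n with
    | zero => simp
    | succ n ih =>
      rw [Finset.sum_range_succ]
      have h1 : (0 : ℝ) < 1 + p + n := by positivity
      have h2 : ((1 + p + n : ℝ) ^ 2)⁻¹ ≤ 2 / (1 + p + n) - 2 / (1 + p + (n + 1 : ℕ)) := by
        push_cast
        rw [div_sub_div _ _ h1.ne' (by positivity), inv_eq_one_div,
          div_le_div_iff₀ (by positivity) (by positivity)]
        have hp : (0 : ℝ) ≤ p := by positivity
        have hn : (0 : ℝ) ≤ n := by positivity
        nlinarith [mul_nonneg h1.le (add_nonneg hp hn)]
      linarith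
  have : (0 : ℝ) ≤ 2 / (1 + p + n) := by positivity
  linarith [h n]

lemma sum_box_inv_sq_le (n : ℕ) :
    ∑ z ∈ Finset.Icc (-n : ℤ) n ×ˢ Finset.Icc (-n : ℤ) n, ((1 + l1Norm z : ℝ) ^ 2)⁻¹ ≤
      8 * (1 + Real.log (1 + n)) := by
  rw [Finset.sum_product]
  have h1 : ∀ p : ℤ, ∑ q ∈ Finset.Icc (-n : ℤ) n, ((1 + l1Norm (p, q) : ℝ) ^ 2)⁻¹ ≤
      4 / (1 + p.natAbs) := by
    intro p
    have h := sum_Icc_natAbs_le (g := fun k => ((1 + p.natAbs + k : ℝ) ^ 2)⁻¹)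
      (fun k => by positivity) n
    have h' := sum_inv_sq_le p.natAbs (n + 1)
    calc ∑ q ∈ Finset.Icc (-n : ℤ) n, ((1 + l1Norm (p, q) : ℝ) ^ 2)⁻¹
        = ∑ q ∈ Finset.Icc (-n : ℤ) n, ((1 + p.natAbs + q.natAbs : ℝ) ^ 2)⁻¹ := by
          refine Finset.sum_congr rfl fun q _ => ?_
          simp only [l1Norm]; push_cast; ring_nf
      _ ≤ 2 * (2 / (1 + p.natAbs)) := h.trans (by gcongr)
      _ = _ := by ring
  refine (Finset.sum_le_sum fun p _ => h1 p).trans ?_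
  refine (sum_Icc_natAbs_le (g := fun k => 4 / (1 + k : ℝ)) (fun k => by positivity) n).trans ?_
  have h2 := harmonic_le_of_le (le_refl (n + 1))
  rw [harmonic] at h2
  push_cast at h2
  have h3 : ∑ k ∈ Finset.range (n + 1), 4 / (1 + k : ℝ) =
      4 * ∑ k ∈ Finset.range (n + 1), (k + 1 : ℝ)⁻¹ := by
    rw [Finset.mul_sum]
    exact Finset.sum_congr rfl fun k _ => by rw [div_eq_mul_inv, add_comm]
  rw [h3]
  linarith

/-- The logarithmic cutoff function at scale `n`. -/
noncomputable def logCutoff (n : ℕ) (z : ℤ × ℤ) : ℝ :=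
  min 1 (Real.log (1 + l1Norm z) / Real.log (1 + n))

lemma logCutoff_zero (n : ℕ) : logCutoff n 0 = 0 := by
  simp [logCutoff, l1Norm]

lemma log_one_add_pos {n : ℕ} (hn : 1 ≤ n) : 0 < Real.log (1 + n) := by
  refine Real.log_pos ?_
  have : (1 : ℝ) ≤ n := by exact_mod_cast hn
  linarith

lemma logCutoff_eq_one {n : ℕ} (hn : 1 ≤ n) {z : ℤ × ℤ} (hz : n ≤ l1Norm z) :
    logCutoff n z = 1 := by
  refine min_eq_left ?_
  rw [one_le_div (log_one_add_pos hn)]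
  have : (n : ℝ) ≤ l1Norm z := by exact_mod_cast hz
  gcongr

lemma logCutoff_nonneg (n : ℕ) (z : ℤ × ℤ) : 0 ≤ logCutoff n z := by
  refine le_min zero_le_one (div_nonneg (Real.log_nonneg ?_) (Real.log_nonneg ?_)) <;>
    simp

lemma logCutoff_le_one (n : ℕ) (z : ℤ × ℤ) : logCutoff n z ≤ 1 := min_le_left _ _

lemma l1Norm_add_unitStep_le (z : ℤ × ℤ) (i : Bool) :
    l1Norm (z + unitStep i) ≤ l1Norm z + 1 ∧ l1Norm z ≤ l1Norm (z + unitStep i) + 1 := by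
  cases i <;> simp only [l1Norm, unitStep, Prod.fst_add, Prod.snd_add] <;> omega

lemma abs_log_sub_log_le {k l : ℕ} (h1 : k ≤ l + 1) (h2 : l ≤ k + 1) :
    |Real.log (1 + k) - Real.log (1 + l)| ≤ 2 / (1 + l) := by
  have key : ∀ k : ℕ, Real.log (1 + (k + 1 : ℕ)) - Real.log (1 + k) ≤ 1 / (1 + k) ∧
      0 ≤ Real.log (1 + (k + 1 : ℕ)) - Real.log (1 + k) := by
    intro k
    have hk : (0 : ℝ) < 1 + k := by positivity
    push_cast
    rw [← Real.log_div (by positivity) hk.ne']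
    constructor
    · refine (Real.log_le_sub_one_of_pos (by positivity)).trans (le_of_eq ?_)
      field_simp
      ring
    · refine Real.log_nonneg ?_
      rw [one_le_div hk]; linarith
  have hl : (0 : ℝ) < 1 + l := by positivity
  obtain h | h | h : k = l ∨ k = l + 1 ∨ l = k + 1 := by omega
  · subst h; simp; positivity
  · subst h
    rw [abs_of_nonneg (key l).2]
    refine (key l).1.trans ?_
    gcongr
    norm_num
  · subst h
    rw [abs_sub_comm, abs_of_nonneg (key k).2]
    refine (key k).1.trans ?_
    push_cast
    rw [div_le_div_iff₀ (by positivity) (by positivity)]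
    have : (0 : ℝ) ≤ k := by positivity
    linarith

/-- Capping at `1` is a contraction, and the logarithm changes by at most `2 / (1 + |z|)` along an
edge at `z`. -/
lemma grad_logCutoff_sq_le {n : ℕ} (hn : 1 ≤ n) (d : OrientedEdge) :
    grad (logCutoff n) d ^ 2 ≤ 4 / Real.log (1 + n) ^ 2 * ((1 + l1Norm d.1 : ℝ) ^ 2)⁻¹ := by
  have hL := log_one_add_pos hn
  obtain ⟨h1, h2⟩ := l1Norm_add_unitStep_le d.1 d.2
  have h3 := abs_log_sub_log_le h1 h2
  have h4 : |grad (logCutoff n) d| ≤ 2 / (1 + l1Norm d.1) / Real.log (1 + n) := by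
    refine (abs_min_sub_min_le_max _ _ _ _).trans ?_
    rw [sub_self, abs_zero, max_eq_right (abs_nonneg _), ← sub_div, abs_div, abs_of_pos hL]
    gcongr
  calc grad (logCutoff n) d ^ 2 = |grad (logCutoff n) d| ^ 2 := (sq_abs _).symm
    _ ≤ (2 / (1 + l1Norm d.1) / Real.log (1 + n)) ^ 2 := by gcongr
    _ = _ := by field_simp; norm_num

lemma grad_logCutoff_eq_zero {n : ℕ} (hn : 1 ≤ n) {d : OrientedEdge}
    (hd : d ∉ (Finset.Icc (-n : ℤ) n ×ˢ Finset.Icc (-n : ℤ) n) ×ˢ (Finset.univ : Finset Bool)) :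
    grad (logCutoff n) d = 0 := by
  have h : n < l1Norm d.1 := by
    simp only [Finset.mem_product, Finset.mem_Icc, Finset.mem_univ, and_true] at hd
    simp only [l1Norm]
    omega
  have h2 := (l1Norm_add_unitStep_le d.1 d.2).2
  rw [grad, logCutoff_eq_one hn h.le, logCutoff_eq_one hn (by omega), sub_self]

lemma finiteEnergy_logCutoff {n : ℕ} (hn : 1 ≤ n) : FiniteEnergy (logCutoff n) :=
  summable_of_ne_finset_zero fun _ hd => by rw [grad_logCutoff_eq_zero hn hd]; simp

/-- The sum of `1 / (1 + |z|)²` over the box is `O(log n)`, against a prefactor `1 / log² n`. That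
this tends to zero is the recurrence of `ℤ²`. The hypothesis `2 ≤ n` makes `log (1 + n) ≥ 1`, which
absorbs the additive constant. -/
theorem tsum_grad_logCutoff_sq_le {n : ℕ} (hn : 2 ≤ n) :
    ∑' d, grad (logCutoff n) d ^ 2 ≤ 128 / Real.log (1 + n) := by
  have hn1 : 1 ≤ n := by omega
  have hL := log_one_add_pos hn1
  rw [tsum_eq_sum (s := (Finset.Icc (-n : ℤ) n ×ˢ Finset.Icc (-n : ℤ) n) ×ˢ Finset.univ)
    fun _ hd => by rw [grad_logCutoff_eq_zero hn1 hd]; simp]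
  refine (Finset.sum_le_sum fun d _ => grad_logCutoff_sq_le hn1 d).trans ?_
  rw [← Finset.mul_sum, Finset.sum_product]
  simp only [Finset.sum_const, Finset.card_univ, Fintype.card_bool, nsmul_eq_mul]
  rw [← Finset.mul_sum]
  have h1 := sum_box_inv_sq_le n
  have hL1 : 1 ≤ Real.log (1 + n) := by
    rw [Real.le_log_iff_exp_le (by positivity)]
    have : (2 : ℝ) ≤ n := by exact_mod_cast hn
    linarith [Real.exp_one_lt_three]
  calc 4 / Real.log (1 + n) ^ 2 * ((2 : ℕ) * ∑ z ∈ Finset.Icc (-n : ℤ) n ×ˢ Finset.Icc (-n : ℤ) n,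
        ((1 + l1Norm z : ℝ) ^ 2)⁻¹)
      ≤ 4 / Real.log (1 + n) ^ 2 * ((2 : ℕ) * (8 * (Real.log (1 + n) + Real.log (1 + n)))) := by
        gcongr
        exact h1.trans (by gcongr)
    _ = _ := by field_simp; norm_num

end LatticeNetwork

/-! ### Bounds on the resistance and on the current -/

namespace LatticeNetwork

variable {m M : ℝ} {c : OrientedEdge → ℝ} {x y : ℤ × ℤ} {u : ℤ × ℤ → ℝ}

lemma one_le_one_add_log (n : ℕ) : 1 ≤ 1 + Real.log (1 + n) := by
  have : 0 ≤ Real.log (1 + n) := Real.log_nonneg (by simp)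
  linarith

lemma IsPotential.tsum_grad_sq_le (hc : Elliptic m M c) (hu : IsPotential c x y u) :
    ∑' d, grad u d ^ 2 ≤ (u x - u y) / m := by
  rw [le_div_iff₀ hc.pos, mul_comm, ← hu.form_self]
  exact hc.energy_le hu.finiteEnergy

/-- The effective resistance is at most logarithmic. -/
theorem IsPotential.sub_le_log (hc : Elliptic m M c) (hu : IsPotential c x y u) :
    u x - u y ≤ 66 / m * (1 + Real.log (1 + l1Norm (y - x))) := by
  have h1 := sub_sq_le_log hu.finiteEnergy x y
  have h2 := hu.tsum_grad_sq_le hc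
  have hL := one_le_one_add_log (l1Norm (y - x))
  set L := 1 + Real.log (1 + (l1Norm (y - x) : ℝ))
  have hm := hc.pos
  rcases (sub_nonneg.2 (hu.sink_le_source hc)).eq_or_lt with h0 | h0
  · rw [← h0]; positivity
  -- The unweighted energy of `u` is itself at most `(u x - u y) / m`, so one factor cancels.
  · have h3 : (u x - u y) ^ 2 ≤ 66 * L * ((u x - u y) / m) := h1.trans (by gcongr)
    have h4 : (u x - u y) * (u x - u y) ≤ (66 / m * L) * (u x - u y) := by
      calc _ = (u x - u y) ^ 2 := by ring
        _ ≤ _ := h3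
        _ = _ := by ring
    exact le_of_mul_le_mul_right h4 h0

/-- The effective resistance is at least logarithmic. -/
theorem IsPotential.log_le_sub (hc : Elliptic m M c) (hu : IsPotential c 0 y u)
    (hy : 2 ≤ l1Norm y) : Real.log (1 + l1Norm y) / (128 * M) ≤ u 0 - u y := by
  have hy1 : 1 ≤ l1Norm y := by omega
  have hφ := finiteEnergy_logCutoff hy1
  -- Cauchy–Schwarz against the cutoff, which rises by `1` from `0` to `y`: the product of
  -- resistance and cutoff energy is at least `1`.
  have h1 := hc.form_sq_le hu.finiteEnergy hφ
  rw [hu.form_eq _ hφ, hu.form_self, logCutoff_zero, logCutoff_eq_one hy1 le_rfl] at h1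
  have hM : 0 < M := hc.pos.trans_le ((hc.lower (0, false)).trans (hc.upper _))
  have h2 := (hc.le_energy hφ).trans
    (mul_le_mul_of_nonneg_left (tsum_grad_logCutoff_sq_le hy) hM.le)
  have hL := log_one_add_pos hy1
  have h3 := h1.trans
    (mul_le_mul_of_nonneg_left h2 (sub_nonneg.2 (hu.sink_le_source hc)))
  rw [div_le_iff₀ (by positivity)]
  have h4 : (u 0 - u y) * (M * (128 / Real.log (1 + l1Norm y))) =
    (u 0 - u y) * (128 * M) / Real.log (1 + l1Norm y) := by ring
  rw [h4, le_div_iff₀ hL] at h3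
  linarith

lemma IsPotential.edge_sub_le (hc : Elliptic m M c) {d : OrientedEdge}
    (hu : IsPotential c (d.1 + unitStep d.2) d.1 u) :
    u (d.1 + unitStep d.2) - u d.1 ≤ 1 / m := by
  have h1 : grad u d ^ 2 ≤ ∑' d, grad u d ^ 2 :=
    hu.finiteEnergy.le_tsum d fun _ _ => sq_nonneg _
  have h2 := h1.trans (hu.tsum_grad_sq_le hc)
  have hm := hc.pos
  rcases (sub_nonneg.2 (hu.sink_le_source hc)).eq_or_lt with h0 | h0
  · rw [← h0]; positivity
  · refine le_of_mul_le_mul_right ?_ h0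
    calc _ = grad u d ^ 2 := by rw [grad]; ring
      _ ≤ _ := h2
      _ = _ := by ring

/-- By reciprocity the gradient at `d` is a difference of two values of the dipole potential across
`d`, which ranges over an interval of length at most `1 / m`. -/
lemma IsPotential.grad_sq_le (hc : Elliptic m M c) (hu : IsPotential c x y u)
    (d : OrientedEdge) : grad u d ^ 2 ≤ 1 / m ^ 2 := by
  obtain ⟨w, hw⟩ := hc.exists_isPotential (d.1 + unitStep d.2) d.1
  have h0 := hw.edge_sub_le hc
  have h1 : |grad u d| ≤ 1 / m := by
    rw [grad, hu.reciprocity hw, abs_le]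
    constructor <;> linarith [hw.le_source hc x, hw.le_source hc y, hw.sink_le hc x, hw.sink_le hc y]
  calc grad u d ^ 2 = |grad u d| ^ 2 := (sq_abs _).symm
    _ ≤ (1 / m) ^ 2 := by gcongr
    _ = _ := by rw [div_pow, one_pow]

lemma boxNorm_unitStep (i : Bool) : boxNorm (unitStep i) ≤ 1 := by
  cases i <;> simp [boxNorm, unitStep]

/-- Decay of the gradient of a potential away from the source and the sink. -/
lemma IsPotential.grad_sq_le_of_far (hc : Elliptic m M c) (hu : IsPotential c x y u)
    {d : OrientedEdge} {n : ℕ} (hn : 1 ≤ n) (hx : n < boxNorm (x - d.1))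
    (hy : n < boxNorm (y - d.1)) : grad u d ^ 2 ≤ 64 / (m ^ 2 * Real.log (1 + n)) := by
  obtain ⟨w, hw⟩ := hc.exists_isPotential (d.1 + unitStep d.2) d.1
  have h0 := hw.edge_sub_le hc
  have hm := hc.pos
  -- Seen from the edge `d`, both `x` and `y` lie outside the box of radius `n`, where the dipole
  -- potential `w` oscillates little.
  have h1 := hw.sub_sq_mul_harmonic_le hc d.1
    (by rw [add_sub_cancel_left]; exact boxNorm_unitStep _) (by simp [boxNorm]) hx hy
  have h2 : Real.log (1 + n) ≤ ∑ j ∈ Finset.Icc 1 n, (1 / j : ℝ) := by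
    have := log_add_one_le_harmonic n
    rw [harmonic_eq_sum_Icc] at this
    push_cast at this
    simpa [add_comm] using this
  have h3 := hw.tsum_grad_sq_le hc
  have h4 : ∑' d, grad w d ^ 2 ≤ 1 / m ^ 2 := by
    refine h3.trans ?_
    rw [div_le_iff₀ hm]
    refine h0.trans (le_of_eq ?_)
    field_simp
  have hg : grad u d = w x - w y := hu.reciprocity hw
  have hL := log_one_add_pos hn
  rw [hg, le_div_iff₀ (by positivity)]
  calc (w x - w y) ^ 2 * (m ^ 2 * Real.log (1 + n))
      = m ^ 2 * ((w x - w y) ^ 2 * Real.log (1 + n)) := by ring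
    _ ≤ m ^ 2 * ((w x - w y) ^ 2 * ∑ j ∈ Finset.Icc 1 n, (1 / j : ℝ)) := by gcongr
    _ ≤ m ^ 2 * (64 * (1 / m ^ 2)) :=
      mul_le_mul_of_nonneg_left (h1.trans (mul_le_mul_of_nonneg_left h4 (by norm_num)))
        (by positivity)
    _ = 64 := by field_simp

/-- By reciprocity the drop is `w x - w y` for the potential `w` from `x` to `z`, hence at most the
resistance between `x` and `z`, whatever the sink of `u`. -/
lemma IsPotential.source_sub_le (hc : Elliptic m M c) (hu : IsPotential c x y u) (z : ℤ × ℤ) :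
    u x - u z ≤ 66 / m * (1 + Real.log (1 + l1Norm (z - x))) := by
  obtain ⟨w, hw⟩ := hc.exists_isPotential x z
  rw [hu.reciprocity hw]
  linarith [hw.sub_le_log hc, hw.sink_le hc y]

/-- The energy of a potential in a superlevel set. -/
lemma IsPotential.sum_le_of_superlevel (hc : Elliptic m M c) (hu : IsPotential c x y u)
    {t : ℝ} (ht : t ≤ u x) (S : Finset OrientedEdge)
    (hS : ∀ d ∈ S, t ≤ u d.1 ∧ t ≤ u (d.1 + unitStep d.2)) :
    ∑ d ∈ S, c d * grad u d ^ 2 ≤ u x - t := by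
  -- Testing with `(u - t)⁺` counts the energy above level `t`; the unit current makes it at most
  -- the drop `u x - t`.
  set f : ℤ × ℤ → ℝ := fun z => max (u z - t) 0
  have htr : ∀ d, grad f d ^ 2 ≤ grad u d * grad f d := fun d => by
    have := max_zero_sub_sq_le (u (d.1 + unitStep d.2) - t) (u d.1 - t)
    simpa [grad, f] using this
  have hf := finiteEnergy_of_truncation hu.finiteEnergy htr
  have h1 := hu.form_eq f hf
  have h2 : f x = u x - t := max_eq_left (by linarith)
  have h3 : 0 ≤ f y := le_max_right _ _
  have h4 : ∑ d ∈ S, c d * grad u d ^ 2 = ∑ d ∈ S, c d * grad u d * grad f d := by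
    refine Finset.sum_congr rfl fun d hd => ?_
    have h5 : f d.1 = u d.1 - t := max_eq_left (by linarith [(hS d hd).1])
    have h6 : f (d.1 + unitStep d.2) = u (d.1 + unitStep d.2) - t :=
      max_eq_left (by linarith [(hS d hd).2])
    rw [grad, grad, h5, h6]
    ring
  have h7 : ∑ d ∈ S, c d * grad u d * grad f d ≤ dirichletForm c u f := by
    refine (hc.summable hu.finiteEnergy hf).sum_le_tsum _ fun d _ => ?_
    rw [mul_assoc]
    exact mul_nonneg (hc.pos_apply d).le ((sq_nonneg _).trans (htr d))
  linarith

/-- Within distance of order `n` of the source, `u` drops by `O(log n)` only, so these edges lie in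
a superlevel set of small energy. -/
lemma IsPotential.sum_grad_sq_near_le (hc : Elliptic m M c) (hu : IsPotential c x y u)
    {n : ℕ} (S : Finset OrientedEdge) (hS : ∀ d ∈ S, boxNorm (x - d.1) ≤ n) :
    ∑ d ∈ S, grad u d ^ 2 ≤ 66 / m ^ 2 * (2 + Real.log (1 + n)) := by
  have hm := hc.pos
  have hL := one_le_one_add_log n
  set B := 66 / m * (2 + Real.log (1 + n)) with hB
  have hB0 : 0 ≤ B := by
    refine mul_nonneg (by positivity) ?_
    linarith
  -- Supremum norm `n` gives `ℓ¹` norm `2n`; the other endpoint of the edge adds `1`.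
  have hz : ∀ z : ℤ × ℤ, l1Norm (z - x) ≤ 2 * n + 1 → u x - B ≤ u z := by
    intro z hz
    have h1 := hu.source_sub_le hc z
    have h2 : Real.log (1 + l1Norm (z - x)) ≤ 1 + Real.log (1 + n) := by
      have h3 : (1 + l1Norm (z - x) : ℝ) ≤ 2 * (1 + n) := by
        have : (l1Norm (z - x) : ℝ) ≤ 2 * n + 1 := by exact_mod_cast hz
        linarith
      calc Real.log (1 + l1Norm (z - x)) ≤ Real.log (2 * (1 + n)) := by gcongr
        _ = Real.log 2 + Real.log (1 + n) := Real.log_mul (by norm_num) (by positivity)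
        _ ≤ _ := by linarith [Real.log_two_lt_d9]
    have h4 : 66 / m * (1 + Real.log (1 + l1Norm (z - x))) ≤ B := by
      rw [hB]; exact mul_le_mul_of_nonneg_left (by linarith) (by positivity)
    linarith
  have h := hu.sum_le_of_superlevel hc (t := u x - B) (by linarith) S fun d hd => by
    have hd' := hS d hd
    have h1 : l1Norm (d.1 - x) ≤ 2 * n := by
      simp only [boxNorm, l1Norm, Prod.fst_sub, Prod.snd_sub] at hd' ⊢
      omega
    have h2 := (l1Norm_add_unitStep_le (d.1 - x) d.2).1
    rw [sub_add_eq_add_sub] at h2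
    exact ⟨hz _ (by omega), hz _ (by omega)⟩
  have h5 : m * ∑ d ∈ S, grad u d ^ 2 ≤ ∑ d ∈ S, c d * grad u d ^ 2 := by
    rw [Finset.mul_sum]
    exact Finset.sum_le_sum fun d _ => mul_le_mul_of_nonneg_right (hc.lower d) (sq_nonneg _)
  have h6 : m * ∑ d ∈ S, grad u d ^ 2 ≤ B := by linarith
  rw [hB] at h6
  rw [← le_div_iff₀' hm] at h6
  refine h6.trans (le_of_eq ?_)
  field_simp

/-- Edges near the source, edges near the sink, and the rest: in each class one squared gradient is
bounded pointwise and the other is summed, using the local energy `O(log n)` or the total energy. -/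
lemma IsPotential.sum_grad_pow_four_le_aux (hc : Elliptic m M c) (hu : IsPotential c x y u)
    (S : Finset OrientedEdge) {n : ℕ} (hn : 1 ≤ n) :
    ∑ d ∈ S, grad u d ^ 4 ≤ 132 / m ^ 4 * (2 + Real.log (1 + n)) +
      4224 / m ^ 4 * ((1 + Real.log (1 + l1Norm (y - x))) / Real.log (1 + n)) := by
  have hm := hc.pos
  have hL := log_one_add_pos hn
  have near : ∀ T : Finset OrientedEdge, ∀ B, ∑ d ∈ T, grad u d ^ 2 ≤ B →
      ∑ d ∈ T, grad u d ^ 4 ≤ 1 / m ^ 2 * B := by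
    intro T B hB
    refine le_trans ?_ (mul_le_mul_of_nonneg_left hB (by positivity))
    rw [Finset.mul_sum]
    refine Finset.sum_le_sum fun d _ => ?_
    rw [show grad u d ^ 4 = grad u d ^ 2 * grad u d ^ 2 by ring]
    exact mul_le_mul_of_nonneg_right (hu.grad_sq_le hc d) (sq_nonneg _)
  have h1 := near _ _ (hu.sum_grad_sq_near_le hc (S.filter fun d => boxNorm (x - d.1) ≤ n)
    fun d hd => (Finset.mem_filter.1 hd).2)
  have h2 := hu.neg.sum_grad_sq_near_le hc
    ((S.filter fun d => ¬ boxNorm (x - d.1) ≤ n).filter fun d => boxNorm (y - d.1) ≤ n)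
    fun d hd => (Finset.mem_filter.1 hd).2
  simp only [grad_neg, neg_sq] at h2
  replace h2 := near _ _ h2
  have h3 : ∑ d ∈ (S.filter fun d => ¬ boxNorm (x - d.1) ≤ n).filter
      (fun d => ¬ boxNorm (y - d.1) ≤ n), grad u d ^ 4 ≤
      64 / (m ^ 2 * Real.log (1 + n)) *
        (66 / m * (1 + Real.log (1 + l1Norm (y - x))) / m) := by
    have h4 : ∑' d, grad u d ^ 2 ≤ 66 / m * (1 + Real.log (1 + l1Norm (y - x))) / m :=
      (hu.tsum_grad_sq_le hc).trans (by gcongr; exact hu.sub_le_log hc)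
    refine le_trans ?_ (mul_le_mul_of_nonneg_left h4 (by positivity))
    refine le_trans ?_ (mul_le_mul_of_nonneg_left (Summable.sum_le_tsum
      ((S.filter fun d => ¬ boxNorm (x - d.1) ≤ n).filter fun d => ¬ boxNorm (y - d.1) ≤ n)
      (fun d _ => sq_nonneg (grad u d)) hu.finiteEnergy) (by positivity))
    rw [Finset.mul_sum]
    refine Finset.sum_le_sum fun d hd => ?_
    simp only [Finset.mem_filter, not_le] at hd
    rw [show grad u d ^ 4 = grad u d ^ 2 * grad u d ^ 2 by ring]
    exact mul_le_mul_of_nonneg_right (hu.grad_sq_le_of_far hc hn hd.1.2 hd.2) (sq_nonneg _)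
  rw [← Finset.sum_filter_add_sum_filter_not S (fun d => boxNorm (x - d.1) ≤ n),
    ← Finset.sum_filter_add_sum_filter_not (S.filter fun d => ¬ boxNorm (x - d.1) ≤ n)
      (fun d => boxNorm (y - d.1) ≤ n)]
  have e1 : 1 / m ^ 2 * (66 / m ^ 2 * (2 + Real.log (1 + n))) =
      66 / m ^ 4 * (2 + Real.log (1 + n)) := by field_simp
  have e2 : 64 / (m ^ 2 * Real.log (1 + n)) *
        (66 / m * (1 + Real.log (1 + l1Norm (y - x))) / m) =
      4224 / m ^ 4 * ((1 + Real.log (1 + l1Norm (y - x))) / Real.log (1 + n)) := by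
    field_simp; ring
  have e3 : 132 / m ^ 4 * (2 + Real.log (1 + n)) = 2 * (66 / m ^ 4 * (2 + Real.log (1 + n))) := by
    ring
  rw [e1] at h1 h2
  rw [e2] at h3
  linarith

/-- The fourth powers of the gradient of a potential sum up to at most the square root of the
logarithm of the distance between the source and the sink. -/
theorem IsPotential.sum_grad_pow_four_le (hc : Elliptic m M c) (hu : IsPotential c x y u)
    (S : Finset OrientedEdge) :
    ∑ d ∈ S, grad u d ^ 4 ≤ 4752 / m ^ 4 * √(1 + Real.log (1 + l1Norm (y - x))) := by
  have hL := one_le_one_add_log (l1Norm (y - x))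
  set L := 1 + Real.log (1 + (l1Norm (y - x) : ℝ))
  have hm := hc.pos
  have hs : 1 ≤ √L := Real.one_le_sqrt.2 hL
  -- This radius makes `log (1 + n)` comparable to `√L`, balancing the near and far contributions.
  set n := ⌊Real.exp √L⌋₊
  have hexp : 1 ≤ Real.exp √L := Real.one_le_exp (by positivity)
  have hn : 1 ≤ n := Nat.le_floor (by simp)
  have h1 : √L ≤ Real.log (1 + n) := by
    rw [Real.le_log_iff_exp_le (by positivity), add_comm]
    exact (Nat.lt_floor_add_one _).le
  have h2 : Real.log (1 + n) ≤ 1 + √L := by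
    rw [Real.log_le_iff_le_exp (by positivity), Real.exp_add]
    have h3 : (n : ℝ) ≤ Real.exp √L := Nat.floor_le (by positivity)
    nlinarith [Real.exp_one_gt_d9]
  have h4 : L / Real.log (1 + n) ≤ √L := by
    rw [div_le_iff₀ (by linarith)]
    calc L = √L * √L := (Real.mul_self_sqrt (by linarith)).symm
      _ ≤ _ := by gcongr
  refine (hu.sum_grad_pow_four_le_aux hc S hn).trans ?_
  have h5 : 132 / m ^ 4 * (2 + Real.log (1 + n)) ≤ 132 / m ^ 4 * (4 * √L) := by
    gcongr; linarith
  have h6 : 4224 / m ^ 4 * (L / Real.log (1 + n)) ≤ 4224 / m ^ 4 * √L := by gcongr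
  have h7 : 4752 / m ^ 4 * √L = 132 / m ^ 4 * (4 * √L) + 4224 / m ^ 4 * √L := by ring
  linarith

end LatticeNetwork

/-! ### Flows, currents and Thomson's principle -/

namespace LatticeNetwork

lemma adj_add_unitStep (x : ℤ × ℤ) (i : Bool) : squareLattice.Adj x (x + unitStep i) := by
  cases i <;> simp [squareLattice, l1Norm, unitStep]

/-- The unoriented edge underlying an oriented edge. -/
def toEdge (d : OrientedEdge) : squareLattice.edgeSet :=
  ⟨s(d.1, d.1 + unitStep d.2), adj_add_unitStep d.1 d.2⟩

lemma toEdge_bijective : Function.Bijective toEdge := by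
  constructor
  · rintro ⟨⟨p, q⟩, i⟩ ⟨⟨p', q'⟩, i'⟩ h
    simp only [toEdge] at h
    cases i <;> cases i' <;> simp [unitStep] at h ⊢ <;> omega
  · rintro ⟨e, he⟩
    induction e using Sym2.ind with
    | _ x y =>
      obtain ⟨p, q⟩ := x
      obtain ⟨p', q'⟩ := y
      have h : (p - p').natAbs + (q - q').natAbs = 1 := he
      obtain ⟨h1, h2⟩ | ⟨h1, h2⟩ | ⟨h1, h2⟩ | ⟨h1, h2⟩ :
          (p' = p + 1 ∧ q' = q) ∨ (p = p' + 1 ∧ q' = q) ∨ (p' = p ∧ q' = q + 1) ∨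
            (p' = p ∧ q = q' + 1) := by omega
      · exact ⟨((p, q), false), by simp [toEdge, unitStep, h1, h2]⟩
      · exact ⟨((p', q'), false), by simp [toEdge, unitStep, h1, h2, Sym2.eq_swap]⟩
      · exact ⟨((p, q), true), by simp [toEdge, unitStep, h1, h2]⟩
      · exact ⟨((p', q'), true), by simp [toEdge, unitStep, h1, h2, Sym2.eq_swap]⟩

/-- The edges of the square lattice correspond to the positively oriented edges. -/
noncomputable def edgeEquiv : OrientedEdge ≃ squareLattice.edgeSet :=
  Equiv.ofBijective toEdge toEdge_bijective

instance countable_edgeSet : Countable squareLattice.edgeSet := Countable.of_equiv _ edgeEquiv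

/-- The divergence of an edge function. -/
def divergence (j : OrientedEdge → ℝ) (x : ℤ × ℤ) : ℝ :=
  ∑ i : Bool, (j (x, i) - j (x - unitStep i, i))

/-- Summation by parts. -/
lemma tsum_mul_grad (j : OrientedEdge → ℝ) {φ : ℤ × ℤ → ℝ} (hφ : φ.support.Finite) :
    ∑' d, j d * grad φ d = -∑' x, φ x * divergence j x := by
  have hfin : ∀ k : OrientedEdge → ℝ, (Function.support fun d => k d * φ d.1).Finite := fun k => by
    refine (hφ.prod (Set.finite_univ (α := Bool))).subset fun d hd => ?_
    simp only [Function.mem_support, ne_eq, mul_eq_zero, not_or] at hd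
    exact ⟨hd.2, trivial⟩
  have hsum : ∀ k : OrientedEdge → ℝ, Summable fun d => k d * φ d.1 := fun k =>
    summable_of_hasFiniteSupport (hfin k)
  let e : OrientedEdge ≃ OrientedEdge :=
    { toFun := fun d => (d.1 + unitStep d.2, d.2)
      invFun := fun d => (d.1 - unitStep d.2, d.2)
      left_inv := fun d => by simp
      right_inv := fun d => by simp }
  let k : OrientedEdge → ℝ := fun d => j (d.1 - unitStep d.2, d.2)
  have h1 : (fun d : OrientedEdge => j d * φ (d.1 + unitStep d.2)) =
      (fun d => k d * φ d.1) ∘ e := by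
    funext d
    simp [k, e]
  have hs1 : Summable fun d : OrientedEdge => j d * φ (d.1 + unitStep d.2) := by
    rw [h1]
    exact e.summable_iff.2 (hsum k)
  have h2 : ∑' d : OrientedEdge, j d * φ (d.1 + unitStep d.2) = ∑' d, k d * φ d.1 := by
    rw [h1]
    exact e.tsum_eq fun d => k d * φ d.1
  calc ∑' d, j d * grad φ d
      = ∑' d : OrientedEdge, (j d * φ (d.1 + unitStep d.2) - j d * φ d.1) :=
        tsum_congr fun d => by rw [grad]; ring
    _ = ∑' d, k d * φ d.1 - ∑' d, j d * φ d.1 := by rw [hs1.tsum_sub (hsum j), h2]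
    _ = ∑' d : OrientedEdge, (k d - j d) * φ d.1 := by
        rw [← (hsum k).tsum_sub (hsum j)]
        exact tsum_congr fun d => by ring
    _ = ∑' x, ∑' i, (k (x, i) - j (x, i)) * φ x := (hsum fun d => k d - j d).tsum_prod
    _ = ∑' x, -(φ x * divergence j x) := tsum_congr fun x => by
        rw [tsum_fintype, divergence, Finset.mul_sum, ← Finset.sum_neg_distrib]
        exact Finset.sum_congr rfl fun i _ => by simp only [k]; ring
    _ = _ := tsum_neg

lemma sum_neighborFinset (g : ℤ × ℤ → ℝ) (x : ℤ × ℤ) :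
    ∑ y ∈ squareLattice.neighborFinset x, g y =
      ∑ i : Bool, (g (x + unitStep i) + g (x - unitStep i)) := by
  obtain ⟨p, q⟩ := x
  have h : squareLattice.neighborFinset (p, q) =
      {(p + 1, q), (p - 1, q), (p, q + 1), (p, q - 1)} := by
    ext ⟨p', q'⟩
    rw [SimpleGraph.mem_neighborFinset]
    simp only [squareLattice, l1Norm, Prod.fst_sub, Prod.snd_sub, Finset.mem_insert,
      Finset.mem_singleton, Prod.mk.injEq]
    omega
  rw [h, Finset.sum_insert (by simp; omega), Finset.sum_insert (by simp), Finset.sum_insert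
    (by simp; omega), Finset.sum_singleton, Fintype.sum_bool]
  simp only [unitStep, Prod.mk_add_mk, Prod.mk_sub_mk, add_zero, sub_zero]
  ring

variable {x y : ℤ × ℤ} {r : squareLattice.edgeSet → ℝ} {a b : ℝ}

/-- The values of a flow on the oriented edges. -/
def flowOn (θ : squareLattice.ElectricFlow x y) (d : OrientedEdge) : ℝ :=
  θ.val d.1 (d.1 + unitStep d.2)

lemma sq_toEdge (θ : squareLattice.ElectricFlow x y) (d : OrientedEdge) :
    θ.sq (toEdge d) = flowOn θ d ^ 2 := rfl

lemma hasSum_energy_iff (θ : squareLattice.ElectricFlow x y) (E : ℝ) :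
    HasSum (fun e : squareLattice.edgeSet => r e * θ.sq e) E ↔
      HasSum (fun d => r (toEdge d) * flowOn θ d ^ 2) E :=
  (edgeEquiv.hasSum_iff (f := fun e : squareLattice.edgeSet => r e * θ.sq e)).symm

lemma divergence_flowOn (θ : squareLattice.ElectricFlow x y) (z : ℤ × ℤ) :
    divergence (flowOn θ) z = ∑ t ∈ squareLattice.neighborFinset z, θ.val z t := by
  rw [sum_neighborFinset, divergence]
  refine Finset.sum_congr rfl fun i _ => ?_
  simp only [flowOn, sub_add_cancel]
  rw [θ.antisymm (z - unitStep i) z]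
  ring

lemma tsum_flowOn_mul_grad (hxy : x ≠ y) (θ : squareLattice.ElectricFlow x y)
    (hθ : θ.strength = 1) {φ : ℤ × ℤ → ℝ} (hφ : φ.support.Finite) :
    ∑' d, flowOn θ d * grad φ d = -(φ x - φ y) := by
  rw [tsum_mul_grad _ hφ, tsum_eq_sum (s := {x, y})]
  · rw [Finset.sum_pair hxy, divergence_flowOn, divergence_flowOn]
    have h1 : ∑ t ∈ squareLattice.neighborFinset x, θ.val x t = 1 := hθ
    have h2 : ∑ t ∈ squareLattice.neighborFinset y, θ.val y t = -1 := by
      rw [← h1, θ.balance, ← Finset.sum_neg_distrib]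
      exact Finset.sum_congr rfl fun t _ => θ.antisymm y t
    rw [h1, h2]
    ring
  · intro z hz
    simp only [Finset.mem_insert, Finset.mem_singleton, not_or] at hz
    rw [divergence_flowOn, θ.node_law z hz.1 hz.2, mul_zero]

lemma tendsto_one_sub_logCutoff (z : ℤ × ℤ) :
    Filter.Tendsto (fun n : ℕ => 1 - logCutoff n z) Filter.atTop (nhds 1) := by
  have h1 : Filter.Tendsto (fun n : ℕ => Real.log (1 + n)) Filter.atTop Filter.atTop :=
    Real.tendsto_log_atTop.comp
      (Filter.tendsto_atTop_add_const_left _ _ tendsto_natCast_atTop_atTop)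
  have h2 : Filter.Tendsto (fun n : ℕ => logCutoff n z) Filter.atTop (nhds 0) := by
    refine squeeze_zero (fun n => logCutoff_nonneg n z) (fun n => min_le_right _ _) ?_
    exact h1.const_div_atTop _
  simpa using h2.const_sub 1

/-- By recurrence of the lattice, the summation by parts formula for a flow of finite energy
holds for all bounded functions of finite energy. -/
lemma tsum_flowOn_mul_grad_of_bounded (hxy : x ≠ y) (θ : squareLattice.ElectricFlow x y)
    (hθ : θ.strength = 1) (hθ2 : Summable fun d => flowOn θ d ^ 2) {u : ℤ × ℤ → ℝ}
    (hu : FiniteEnergy u) {B : ℝ} (hB : ∀ z, |u z| ≤ B) :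
    ∑' d, flowOn θ d * grad u d = -(u x - u y) := by
  have hθu2 : Summable fun d : OrientedEdge => (flowOn θ d * u (d.1 + unitStep d.2)) ^ 2 := by
    refine Summable.of_nonneg_of_le (fun _ => sq_nonneg _) (fun d => ?_) (hθ2.mul_left (B ^ 2))
    rw [mul_pow, mul_comm]
    gcongr ?_ * _
    rw [← sq_abs]
    gcongr
    exact hB _
  set η : ℕ → ℤ × ℤ → ℝ := fun n z => 1 - logCutoff n z
  have hη : ∀ n d, grad (η n) d = -grad (logCutoff n) d := fun n d => by
    simp only [grad, η]; ring
  have hηfin : ∀ n, 1 ≤ n → FiniteEnergy (η n) := fun n hn => by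
    simpa only [FiniteEnergy, hη, neg_sq] using finiteEnergy_logCutoff hn
  have hη0 : ∀ n z, |η n z| ≤ 1 := fun n z => by
    rw [abs_le]
    constructor <;> simp only [η] <;> linarith [logCutoff_nonneg n z, logCutoff_le_one n z]
  have hθg := summable_mul_of_sq hθ2 hu
  have lim1 : Filter.Tendsto (fun n => ∑' d : OrientedEdge, η n d.1 * (flowOn θ d * grad u d))
      Filter.atTop (nhds (∑' d, flowOn θ d * grad u d)) := by
    refine tendsto_tsum_of_dominated_convergence hθg.abs (fun d => ?_)
      (Filter.Eventually.of_forall fun n d => ?_)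
    · simpa using (tendsto_one_sub_logCutoff d.1).mul_const (flowOn θ d * grad u d)
    · rw [Real.norm_eq_abs, abs_mul]
      exact mul_le_of_le_one_left (abs_nonneg _) (hη0 n d.1)
  -- The error created by the cutoff vanishes by Cauchy–Schwarz, since the energy of the cutoffs
  -- tends to zero.
  have lim2 : Filter.Tendsto
      (fun n => ∑' d : OrientedEdge, (flowOn θ d * u (d.1 + unitStep d.2)) * grad (η n) d)
      Filter.atTop (nhds 0) := by
    rw [tendsto_zero_iff_abs_tendsto_zero]
    have hK : Filter.Tendsto (fun n : ℕ =>
        √((∑' d : OrientedEdge, (flowOn θ d * u (d.1 + unitStep d.2)) ^ 2) *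
          (128 / Real.log (1 + n)))) Filter.atTop (nhds 0) := by
      have h1 : Filter.Tendsto (fun n : ℕ => Real.log (1 + n)) Filter.atTop Filter.atTop :=
        Real.tendsto_log_atTop.comp
          (Filter.tendsto_atTop_add_const_left _ _ tendsto_natCast_atTop_atTop)
      have h2 := (h1.const_div_atTop 128).const_mul
        (∑' d : OrientedEdge, (flowOn θ d * u (d.1 + unitStep d.2)) ^ 2)
      rw [mul_zero] at h2
      simpa [Function.comp_def] using (Real.continuous_sqrt.tendsto 0).comp h2
    refine squeeze_zero' (Filter.Eventually.of_forall fun n => abs_nonneg _) ?_ hK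
    filter_upwards [Filter.eventually_ge_atTop 2] with n hn
    refine Real.abs_le_sqrt ?_
    refine (tsum_mul_sq_le hθu2 (hηfin n (by omega))).trans ?_
    refine mul_le_mul_of_nonneg_left ?_ (tsum_nonneg fun _ => sq_nonneg _)
    simpa only [hη, neg_sq] using tsum_grad_logCutoff_sq_le hn
  have lim3 : Filter.Tendsto (fun n => -(u x * η n x - u y * η n y)) Filter.atTop
      (nhds (-(u x - u y))) := by
    have := (((tendsto_one_sub_logCutoff x).const_mul (u x)).sub
      ((tendsto_one_sub_logCutoff y).const_mul (u y))).neg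
    simpa using this
  have hlim := lim2.add lim1
  rw [zero_add] at hlim
  refine tendsto_nhds_unique hlim (lim3.congr' ?_)
  filter_upwards [Filter.eventually_ge_atTop 1] with n hn
  have hsupp : (Function.support fun z => u z * η n z).Finite := by
    refine ((Finset.Icc (-n : ℤ) n ×ˢ Finset.Icc (-n : ℤ) n).finite_toSet).subset fun z hz => ?_
    by_contra hz'
    refine hz ?_
    have : n ≤ l1Norm z := by
      simp only [Finset.coe_product, Finset.coe_Icc, Set.mem_prod, Set.mem_Icc] at hz'
      simp only [l1Norm]
      omega
    simp [η, logCutoff_eq_one hn this]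
  rw [← tsum_flowOn_mul_grad hxy θ hθ hsupp]
  have hs1 : Summable fun d : OrientedEdge =>
      (flowOn θ d * u (d.1 + unitStep d.2)) * grad (η n) d :=
    summable_mul_of_sq hθu2 (hηfin n hn)
  have hs2 : Summable fun d : OrientedEdge => η n d.1 * (flowOn θ d * grad u d) := by
    refine Summable.of_norm_bounded hθg.abs fun d => ?_
    rw [Real.norm_eq_abs, abs_mul]
    exact mul_le_of_le_one_left (abs_nonneg _) (hη0 n d.1)
  rw [← hs1.tsum_add hs2]
  -- The discrete product rule, with `u` taken at the tip of the edge and the cutoff at its tail.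
  exact tsum_congr fun d => by simp only [grad]; ring

/-- The conductances associated with resistances. -/
noncomputable def conductance (r : squareLattice.edgeSet → ℝ) (d : OrientedEdge) : ℝ :=
  (r (toEdge d))⁻¹

lemma elliptic_conductance (ha : 0 < a) (hr : ∀ e, a ≤ r e ∧ r e ≤ b) :
    Elliptic b⁻¹ a⁻¹ (conductance r) where
  pos := inv_pos.2 (ha.trans_le ((hr (toEdge (0, false))).1.trans (hr _).2))
  lower _ := inv_anti₀ (ha.trans_le (hr _).1) (hr _).2
  upper _ := inv_anti₀ ha (hr _).1

/-- Test the defining identity of the potential with the indicator of `z`: this yields Kirchhoff's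
node law. -/
lemma IsPotential.divergence_eq {c : OrientedEdge → ℝ} {u : ℤ × ℤ → ℝ}
    (hu : IsPotential c x y u) (z : ℤ × ℤ) :
    divergence (fun d => c d * grad u d) z =
      -((Pi.single z 1 : ℤ × ℤ → ℝ) x - (Pi.single z 1 : ℤ × ℤ → ℝ) y) := by
  have hsupp : (Function.support (Pi.single z 1 : ℤ × ℤ → ℝ)).Finite :=
    (Set.finite_singleton z).subset (by simp)
  have hfin : FiniteEnergy (Pi.single z 1 : ℤ × ℤ → ℝ) := by
    refine summable_of_hasFiniteSupport (Set.Finite.subset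
      (s := ((hsupp.toFinset ∪ hsupp.toFinset.image (· - (1, 0)) ∪
        hsupp.toFinset.image (· - (0, 1))) ×ˢ (Finset.univ : Finset Bool) : Finset _))
      (Finset.finite_toSet _) fun d hd => ?_)
    simp only [Function.mem_support, grad] at hd
    by_contra hd'
    simp only [Finset.coe_product, Finset.coe_union, Finset.coe_image, Set.Finite.coe_toFinset,
      Set.mem_prod, Set.mem_union, Set.mem_image, Finset.mem_coe, Finset.mem_univ, and_true,
      not_or, not_exists, not_and, Function.mem_support, not_not] at hd'
    obtain ⟨⟨h1, h2⟩, h3⟩ := hd'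
    have h4 : (Pi.single z 1 : ℤ × ℤ → ℝ) (d.1 + unitStep d.2) = 0 := by
      by_contra h
      obtain ⟨w, i⟩ := d
      cases i
      · exact h2 _ h (by simp [unitStep])
      · exact h3 _ h (by simp [unitStep])
    simp [h1, h4] at hd
  have h := hu.form_eq _ hfin
  rw [dirichletForm, tsum_mul_grad (fun d => c d * grad u d) hsupp,
    tsum_eq_single z (fun w hw => by simp [hw])] at h
  rw [← h]
  simp

/-- The current flow of a potential. -/
noncomputable def currentFlow (hxy : x ≠ y) {u : ℤ × ℤ → ℝ}
    (hu : IsPotential (conductance r) x y u) : squareLattice.ElectricFlow x y := by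
  classical
  let val : ℤ × ℤ → ℤ × ℤ → ℝ := fun z w =>
    if h : squareLattice.Adj z w then (u z - u w) * (r ⟨s(z, w), h⟩)⁻¹ else 0
  have hanti : ∀ z w, val z w = -val w z := by
    intro z w
    by_cases h : squareLattice.Adj z w
    · have he : (⟨s(z, w), h⟩ : squareLattice.edgeSet) = ⟨s(w, z), h.symm⟩ :=
        Subtype.ext Sym2.eq_swap
      simp only [val, h, h.symm, dif_pos, he]
      ring
    · have h' : ¬ squareLattice.Adj w z := fun h' => h h'.symm
      simp [val, h, h']
  have hval : ∀ z i, val z (z + unitStep i) = -(conductance r (z, i) * grad u (z, i)) := by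
    intro z i
    simp only [val, adj_add_unitStep z i, dif_pos, conductance, toEdge, grad]
    ring
  have hnode : ∀ z, ∑ w ∈ squareLattice.neighborFinset z, val z w =
      (Pi.single z 1 : ℤ × ℤ → ℝ) x - (Pi.single z 1 : ℤ × ℤ → ℝ) y := by
    intro z
    rw [← neg_inj, ← hu.divergence_eq z, sum_neighborFinset, divergence,
      ← Finset.sum_neg_distrib]
    refine Finset.sum_congr rfl fun i _ => ?_
    have h1 := hval (z - unitStep i) i
    rw [sub_add_cancel] at h1
    rw [hval, hanti z (z - unitStep i), h1]
    ring
  exact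
    { val := val
      antisymm := hanti
      eq_zero_of_not_adj := fun z w h => by simp [val, h]
      node_law := fun z h1 h2 => by rw [hnode]; simp [h1.symm, h2.symm]
      balance := by
        have h : ∑ w ∈ squareLattice.neighborFinset y, val w y =
            -∑ w ∈ squareLattice.neighborFinset y, val y w := by
          rw [← Finset.sum_neg_distrib]
          exact Finset.sum_congr rfl fun w _ => hanti w y
        rw [h, hnode, hnode]
        simp [hxy, hxy.symm] }

lemma flowOn_currentFlow (hxy : x ≠ y) {u : ℤ × ℤ → ℝ}
    (hu : IsPotential (conductance r) x y u) (d : OrientedEdge) :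
    flowOn (currentFlow hxy hu) d = -(conductance r d * grad u d) := by
  simp only [flowOn, currentFlow, adj_add_unitStep d.1 d.2, dif_pos, conductance, toEdge, grad]
  ring

lemma strength_currentFlow (hxy : x ≠ y) {u : ℤ × ℤ → ℝ}
    (hu : IsPotential (conductance r) x y u) : (currentFlow hxy hu).strength = 1 := by
  rw [SimpleGraph.ElectricFlow.strength, ← divergence_flowOn]
  have h := hu.divergence_eq x
  simp only [Pi.single_eq_same, Pi.single_eq_of_ne hxy.symm, sub_zero] at h
  rw [← neg_inj, ← h, divergence, divergence, ← Finset.sum_neg_distrib]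
  exact Finset.sum_congr rfl fun i _ => by rw [flowOn_currentFlow, flowOn_currentFlow]; ring

lemma hasSum_currentFlow (ha : 0 < a) (hr : ∀ e, a ≤ r e ∧ r e ≤ b) (hxy : x ≠ y)
    {u : ℤ × ℤ → ℝ} (hu : IsPotential (conductance r) x y u) :
    HasSum (fun e : squareLattice.edgeSet => r e * (currentFlow hxy hu).sq e) (u x - u y) := by
  rw [hasSum_energy_iff, ← hu.form_self, dirichletForm]
  convert ((elliptic_conductance ha hr).summable hu.finiteEnergy hu.finiteEnergy).hasSum using 2
    with d
  rw [flowOn_currentFlow, conductance]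
  have : r (toEdge d) ≠ 0 := (ha.trans_le (hr _).1).ne'
  field_simp

/-- Thomson's principle. -/
lemma IsPotential.sub_le_of_hasSum (ha : 0 < a) (hr : ∀ e, a ≤ r e ∧ r e ≤ b) (hxy : x ≠ y)
    {u : ℤ × ℤ → ℝ} (hu : IsPotential (conductance r) x y u)
    (θ : squareLattice.ElectricFlow x y) (hθ : θ.strength = 1) {E : ℝ}
    (hE : HasSum (fun e : squareLattice.edgeSet => r e * θ.sq e) E) : u x - u y ≤ E := by
  have hc := elliptic_conductance ha hr
  rw [hasSum_energy_iff] at hE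
  have hθ2 : Summable fun d => flowOn θ d ^ 2 := by
    refine Summable.of_nonneg_of_le (fun _ => sq_nonneg _) (fun d => ?_) (hE.summable.mul_left a⁻¹)
    rw [← mul_assoc]
    refine le_mul_of_one_le_left (sq_nonneg _) ?_
    rw [inv_mul_eq_div, one_le_div ha]
    exact (hr _).1
  -- The maximum principle supplies the boundedness of `u` that the summation by parts needs.
  have h1 := tsum_flowOn_mul_grad_of_bounded hxy θ hθ hθ2 hu.finiteEnergy
    (B := max |u y| |u x|) fun z => abs_le_max_abs_abs (hu.sink_le hc z) (hu.le_source hc z)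
  have h2 := (summable_mul_of_sq hθ2 hu.finiteEnergy).hasSum
  rw [h1] at h2
  have h3 := (hc.summable hu.finiteEnergy hu.finiteEnergy).hasSum
  rw [← dirichletForm, hu.form_self] at h3
  have h4 := (hE.add (h2.mul_left 2)).add h3
  -- The sum is `E - (u x - u y)`, and its terms are the complete squares `r (θ + c ∇u)²`; the
  -- current is `-c ∇u`.
  have h5 := h4.nonneg fun d => by
    have hrd : 0 < r (toEdge d) := ha.trans_le (hr _).1
    have : r (toEdge d) * flowOn θ d ^ 2 + 2 * (flowOn θ d * grad u d) +
        conductance r d * grad u d * grad u d =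
        r (toEdge d) * (flowOn θ d + conductance r d * grad u d) ^ 2 := by
      rw [conductance]
      field_simp
      ring
    rw [this]
    positivity
  linarith

lemma bddBelow_energies (hr : ∀ e, 0 ≤ r e) :
    BddBelow {E : ℝ | ∃ θ : squareLattice.ElectricFlow x y, θ.strength = 1 ∧
      HasSum (fun e : squareLattice.edgeSet => r e * θ.sq e) E} := by
  refine ⟨0, ?_⟩
  rintro E ⟨θ, -, hE⟩
  rw [hasSum_energy_iff] at hE
  exact hE.nonneg fun d => mul_nonneg (hr _) (sq_nonneg _)

theorem effectiveResistance_eq (ha : 0 < a) (hr : ∀ e, a ≤ r e ∧ r e ≤ b) (hxy : x ≠ y)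
    {u : ℤ × ℤ → ℝ} (hu : IsPotential (conductance r) x y u) :
    squareLattice.effectiveResistance r x y = u x - u y := by
  have hmem : u x - u y ∈ {E : ℝ | ∃ θ : squareLattice.ElectricFlow x y, θ.strength = 1 ∧
      HasSum (fun e : squareLattice.edgeSet => r e * θ.sq e) E} :=
    ⟨currentFlow hxy hu, strength_currentFlow hxy hu, hasSum_currentFlow ha hr hxy hu⟩
  refine le_antisymm (csInf_le (bddBelow_energies fun e => ha.le.trans (hr e).1) hmem)
    (le_csInf ⟨_, hmem⟩ ?_)
  rintro E ⟨θ, hθ, hE⟩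
  exact hu.sub_le_of_hasSum ha hr hxy θ hθ hE

end LatticeNetwork

/-! ### Efron–Stein and the variance with finitely many random edges -/

namespace LatticeNetwork

section EfronStein

variable {ι : Type*} [DecidableEq ι]

/-- Flipping the coordinate `e`. -/
def flipAt (e : ι) (σ : ι → Bool) : ι → Bool := Function.update σ e (!σ e)

lemma flipAt_same (e : ι) (σ : ι → Bool) : flipAt e σ e = !σ e := by simp [flipAt]

lemma flipAt_of_ne {e i : ι} (h : i ≠ e) (σ : ι → Bool) : flipAt e σ i = σ i := by
  simp [flipAt, h]

lemma flipAt_involutive (e : ι) : Function.Involutive (flipAt e) := fun σ => by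
  funext i
  by_cases h : i = e
  · subst h; simp [flipAt_same]
  · simp [flipAt_of_ne h]

lemma flipAt_comm {e e' : ι} (h : e ≠ e') (σ : ι → Bool) :
    flipAt e (flipAt e' σ) = flipAt e' (flipAt e σ) := by
  funext i
  by_cases h1 : i = e
  · subst h1; simp [flipAt_same, flipAt_of_ne h]
  · by_cases h2 : i = e'
    · subst h2; simp [flipAt_same, flipAt_of_ne h.symm]
    · simp [flipAt_of_ne h1, flipAt_of_ne h2]

variable [Fintype ι]

lemma sum_flipAt (e : ι) (g : (ι → Bool) → ℝ) : ∑ σ, g (flipAt e σ) = ∑ σ, g σ :=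
  Equiv.sum_comp (flipAt_involutive e).toPerm g

/-- The Efron–Stein inequality on the discrete cube, for functions of the coordinates in `s`. -/
lemma efron_stein_of_dependsOn (s : Finset ι) (g : (ι → Bool) → ℝ)
    (hg : ∀ σ τ : ι → Bool, (∀ i ∈ s, σ i = τ i) → g σ = g τ) :
    Fintype.card (ι → Bool) * ∑ σ, g σ ^ 2 - (∑ σ, g σ) ^ 2 ≤
      Fintype.card (ι → Bool) / 4 * ∑ e ∈ s, ∑ σ, (g σ - g (flipAt e σ)) ^ 2 := by
  induction s using Finset.induction_on generalizing g with
  | empty =>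
    have h : ∀ σ, g σ = g fun _ => false := fun σ => hg _ _ (by simp)
    simp only [Finset.sum_empty, mul_zero]
    simp_rw [h]
    simp only [Finset.sum_const, Finset.card_univ, nsmul_eq_mul]
    exact le_of_eq (by ring)
  | insert e s hes ih =>
    -- `G` averages out the coordinate `e`. The variance of `g` is that of `G` plus the contribution
    -- of `e`, and by convexity averaging does not increase the influences of the other coordinates.
    set G : (ι → Bool) → ℝ := fun σ => (g σ + g (flipAt e σ)) / 2 with hG
    have hdep : ∀ σ τ : ι → Bool, (∀ i ∈ s, σ i = τ i) → G σ = G τ := by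
      intro σ τ h
      by_cases he : σ e = τ e
      · have h1 : ∀ i ∈ insert e s, σ i = τ i := fun i hi => by
          rcases Finset.mem_insert.1 hi with rfl | hi
          exacts [he, h i hi]
        have h2 : ∀ i ∈ insert e s, flipAt e σ i = flipAt e τ i := fun i hi => by
          by_cases hie : i = e
          · subst hie; simp [flipAt_same, he]
          · simpa [flipAt_of_ne hie] using h1 i hi
        simp only [hG, hg _ _ h1, hg _ _ h2]
      · have he' : σ e = !τ e := by
          cases h1 : σ e <;> cases h2 : τ e <;> simp_all
        have h1 : ∀ i ∈ insert e s, σ i = flipAt e τ i := fun i hi => by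
          by_cases hie : i = e
          · subst hie; rw [flipAt_same, he']
          · rw [flipAt_of_ne hie]
            exact h i ((Finset.mem_insert.1 hi).resolve_left hie)
        have h2 : ∀ i ∈ insert e s, flipAt e σ i = τ i := fun i hi => by
          by_cases hie : i = e
          · subst hie; rw [flipAt_same, he', Bool.not_not]
          · rw [flipAt_of_ne hie]
            exact h i ((Finset.mem_insert.1 hi).resolve_left hie)
        simp only [hG, hg _ _ h1, hg _ _ h2]
        ring
    have hsum : ∑ σ, G σ = ∑ σ, g σ := by
      simp only [hG, ← Finset.sum_div, Finset.sum_add_distrib]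
      rw [sum_flipAt e g]
      ring
    have hsq : ∑ σ, g σ ^ 2 = ∑ σ, G σ ^ 2 + 1 / 4 * ∑ σ, (g σ - g (flipAt e σ)) ^ 2 := by
      have h1 : ∑ σ, (g σ ^ 2 + g (flipAt e σ) ^ 2) =
          ∑ σ, (2 * G σ ^ 2 + 1 / 2 * (g σ - g (flipAt e σ)) ^ 2) :=
        Finset.sum_congr rfl fun σ _ => by simp only [hG]; ring
      rw [Finset.sum_add_distrib, Finset.sum_add_distrib, ← Finset.mul_sum, ← Finset.mul_sum,
        sum_flipAt e fun σ => g σ ^ 2] at h1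
      linarith
    have hle : ∀ e' ∈ s, ∑ σ, (G σ - G (flipAt e' σ)) ^ 2 ≤
        ∑ σ, (g σ - g (flipAt e' σ)) ^ 2 := by
      intro e' he'
      have hne : e ≠ e' := fun h => hes (h ▸ he')
      have h1 : ∑ σ, (G σ - G (flipAt e' σ)) ^ 2 ≤
          ∑ σ, (1 / 2 * (g σ - g (flipAt e' σ)) ^ 2 +
            1 / 2 * (g (flipAt e σ) - g (flipAt e' (flipAt e σ))) ^ 2) := by
        refine Finset.sum_le_sum fun σ _ => ?_
        simp only [hG, flipAt_comm hne]
        set A := g σ - g (flipAt e' σ) with hA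
        set B := g (flipAt e σ) - g (flipAt e' (flipAt e σ)) with hB
        have : (g σ + g (flipAt e σ)) / 2 - (g (flipAt e' σ) + g (flipAt e' (flipAt e σ))) / 2 =
          (A + B) / 2 := by rw [hA, hB]; ring
        rw [this]
        nlinarith [sq_nonneg (A - B)]
      rw [Finset.sum_add_distrib, ← Finset.mul_sum, ← Finset.mul_sum,
        sum_flipAt e fun σ => (g σ - g (flipAt e' σ)) ^ 2] at h1
      linarith
    have key := ih G hdep
    have hle' := Finset.sum_le_sum hle
    rw [Finset.sum_insert hes, hsq, ← hsum]
    have hN : (0 : ℝ) ≤ Fintype.card (ι → Bool) / 4 := by positivity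
    have := mul_le_mul_of_nonneg_left hle' hN
    linarith

theorem efron_stein (g : (ι → Bool) → ℝ) :
    Fintype.card (ι → Bool) * ∑ σ, g σ ^ 2 - (∑ σ, g σ) ^ 2 ≤
      Fintype.card (ι → Bool) / 4 * ∑ e, ∑ σ, (g σ - g (flipAt e σ)) ^ 2 :=
  efron_stein_of_dependsOn Finset.univ g fun _ _ h => congrArg g (funext fun i => h i (by simp))

end EfronStein

variable {a b : ℝ} {v : ℤ × ℤ}

/-- The squares of the values of the unit current flow. -/
theorem exists_current_sq (ha : 0 < a) (hv : v ≠ 0) {r : squareLattice.edgeSet → ℝ}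
    (hr : ∀ e, a ≤ r e ∧ r e ≤ b) :
    ∃ q : squareLattice.edgeSet → ℝ, (∀ e, 0 ≤ q e) ∧
      HasSum (fun e => r e * q e) (squareLattice.effectiveResistance r 0 v) ∧
      (∀ r' : squareLattice.edgeSet → ℝ, (∀ e, 0 ≤ r' e) → ∀ E, HasSum (fun e => r' e * q e) E →
        squareLattice.effectiveResistance r' 0 v ≤ E) ∧
      ∀ S : Finset squareLattice.edgeSet,
        ∑ e ∈ S, q e ^ 2 ≤ 4752 * b ^ 4 / a ^ 4 * √(1 + Real.log (1 + l1Norm v)) := by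
  have hc := elliptic_conductance ha hr
  have hb : 0 < b := inv_pos.1 hc.pos
  obtain ⟨u, hu⟩ := hc.exists_isPotential 0 v
  refine ⟨fun e => (currentFlow hv.symm hu).sq e, fun e => ?_, ?_, fun r' hr' E hE => ?_,
    fun S => ?_⟩
  · obtain ⟨d, rfl⟩ := toEdge_bijective.2 e
    exact sq_nonneg (flowOn (currentFlow hv.symm hu) d)
  · rw [effectiveResistance_eq ha hr hv.symm hu]
    exact hasSum_currentFlow ha hr hv.symm hu
  · exact csInf_le (bddBelow_energies hr') ⟨_, strength_currentFlow hv.symm hu, hE⟩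
  -- With conductances in `[1/b, 1/a]`, converting gradients to currents costs `1 / a⁴` and the
  -- gradient bound costs `b⁴`.
  · have h1 : ∑ e ∈ S, (currentFlow hv.symm hu).sq e ^ 2 =
        ∑ d ∈ S.map edgeEquiv.symm.toEmbedding, (conductance r d * grad u d) ^ 4 := by
      rw [Finset.sum_map]
      refine Finset.sum_congr rfl fun e _ => ?_
      obtain ⟨d, rfl⟩ := edgeEquiv.surjective e
      simp only [Equiv.coe_toEmbedding, Equiv.symm_apply_apply]
      change (currentFlow hv.symm hu).sq (toEdge d) ^ 2 = _
      rw [sq_toEdge, flowOn_currentFlow]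
      ring
    have h2 := hu.sum_grad_pow_four_le hc (S.map edgeEquiv.symm.toEmbedding)
    rw [sub_zero] at h2
    rw [h1]
    calc ∑ d ∈ S.map edgeEquiv.symm.toEmbedding, (conductance r d * grad u d) ^ 4
        ≤ ∑ d ∈ S.map edgeEquiv.symm.toEmbedding, (a⁻¹) ^ 4 * grad u d ^ 4 := by
          refine Finset.sum_le_sum fun d _ => ?_
          rw [mul_pow]
          have := (hc.pos_apply d).le
          have h4 : 0 ≤ grad u d ^ 4 := by positivity
          gcongr
          exact hc.upper d
      _ ≤ (a⁻¹) ^ 4 * (4752 / (b⁻¹) ^ 4 * √(1 + Real.log (1 + l1Norm v))) := by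
          rw [← Finset.mul_sum]; gcongr
      _ = _ := by field_simp

/-- The optimal flow for `r'` is a competitor for `r`, with no larger energy. -/
lemma effectiveResistance_mono (ha : 0 < a) (hv : v ≠ 0) {r r' : squareLattice.edgeSet → ℝ}
    (hr : ∀ e, a ≤ r e) (hrr' : ∀ e, r e ≤ r' e) (hr' : ∀ e, r' e ≤ b) :
    squareLattice.effectiveResistance r 0 v ≤ squareLattice.effectiveResistance r' 0 v := by
  obtain ⟨q, hq, hsum, hle, -⟩ :=
    exists_current_sq ha hv (r := r') fun e => ⟨(hr e).trans (hrr' e), hr' e⟩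
  have hs : Summable fun e => r e * q e :=
    Summable.of_nonneg_of_le (fun e => mul_nonneg (ha.le.trans (hr e)) (hq e))
      (fun e => mul_le_mul_of_nonneg_right (hrr' e) (hq e)) hsum.summable
  exact (hle r (fun e => ha.le.trans (hr e)) _ hs.hasSum).trans
    (hasSum_le (fun e => mul_le_mul_of_nonneg_right (hrr' e) (hq e)) hs.hasSum hsum)

/-- Here `q` is the squared optimal flow for `r`; kept as a competitor for `r'`, it changes energy
only at `e₀`. -/
lemma effectiveResistance_update_le {r r' q : squareLattice.edgeSet → ℝ} {R : ℝ}
    (hsum : HasSum (fun e => r e * q e) R)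
    (hle : ∀ r' : squareLattice.edgeSet → ℝ, (∀ e, 0 ≤ r' e) → ∀ E,
      HasSum (fun e => r' e * q e) E → squareLattice.effectiveResistance r' 0 v ≤ E)
    (hr' : ∀ e, 0 ≤ r' e) (e₀ : squareLattice.edgeSet) (h : ∀ e, e ≠ e₀ → r' e = r e) :
    squareLattice.effectiveResistance r' 0 v ≤ R + (r' e₀ - r e₀) * q e₀ := by
  classical
  refine hle r' hr' _ ?_
  convert hsum.add (hasSum_ite_eq e₀ ((r' e₀ - r e₀) * q e₀)) using 2 with e
  by_cases he : e = e₀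
  · subst he; simp; ring
  · simp [he, h e he]

/-- The configuration of resistances which is encoded by a configuration of coin flips. -/
def ofCoins (a b : ℝ) {ι : Type*} (σ : ι → Bool) (e : ι) : ℝ := if σ e then a else b

lemma ofCoins_mem (hab : a ≤ b) {ι : Type*} (σ : ι → Bool) (e : ι) :
    a ≤ ofCoins a b σ e ∧ ofCoins a b σ e ≤ b := by
  unfold ofCoins
  split_ifs <;> simp [hab]

open Classical in
/-- The coin flips in a finite set `F` of edges, and `false` outside. -/
noncomputable def extendCoins (F : Finset squareLattice.edgeSet) (τ : F → Bool)
    (e : squareLattice.edgeSet) : Bool := if h : e ∈ F then τ ⟨e, h⟩ else false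

/-- The variance, multiplied by the square of the number of configurations, of the effective
resistance with random resistances in a finite set of edges. -/
theorem finite_variance_le (ha : 0 < a) (hab : a ≤ b) (hv : v ≠ 0)
    (F : Finset squareLattice.edgeSet) :
    Fintype.card (F → Bool) * ∑ τ : F → Bool,
        squareLattice.effectiveResistance (ofCoins a b (extendCoins F τ)) 0 v ^ 2 -
      (∑ τ : F → Bool,
        squareLattice.effectiveResistance (ofCoins a b (extendCoins F τ)) 0 v) ^ 2 ≤
      Fintype.card (F → Bool) ^ 2 *
        (2376 * (b - a) ^ 2 * b ^ 4 / a ^ 4 * √(1 + Real.log (1 + l1Norm v))) := by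
  classical
  set K := 4752 * b ^ 4 / a ^ 4 * √(1 + Real.log (1 + l1Norm v)) with hK
  set r : (F → Bool) → squareLattice.edgeSet → ℝ := fun τ => ofCoins a b (extendCoins F τ)
  have hr : ∀ τ e, a ≤ r τ e ∧ r τ e ≤ b := fun τ e => ofCoins_mem hab _ e
  choose q hq hsum hle hq2 using fun τ => exists_current_sq ha hv (hr τ)
  have hflip : ∀ τ (i : F) (e : squareLattice.edgeSet), e ≠ i → r (flipAt i τ) e = r τ e := by
    intro τ i e hne
    simp only [r, ofCoins, extendCoins]
    by_cases h : e ∈ F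
    · have : (⟨e, h⟩ : F) ≠ i := fun h' => hne (by rw [← h'])
      simp [h, flipAt_of_ne this]
    · simp [h]
  have hone : ∀ τ (i : F), squareLattice.effectiveResistance (r (flipAt i τ)) 0 v -
      squareLattice.effectiveResistance (r τ) 0 v ≤ (b - a) * q τ i := by
    intro τ i
    have h1 := effectiveResistance_update_le (hsum τ) (hle τ)
      (fun e => ha.le.trans (hr (flipAt i τ) e).1) i (hflip τ i)
    have h2 : (r (flipAt i τ) i - r τ i) * q τ i ≤ (b - a) * q τ i :=
      mul_le_mul_of_nonneg_right (by linarith [(hr (flipAt i τ) i).2, (hr τ i).1]) (hq τ i)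
    linarith
  -- Each one-sided bound uses the current before its flip, so the sign of the difference decides
  -- which configuration's current enters; keeping both covers either case. Summed over
  -- configurations the two contributions coincide.
  have hsq : ∀ (i : F) τ, (squareLattice.effectiveResistance (r τ) 0 v -
      squareLattice.effectiveResistance (r (flipAt i τ)) 0 v) ^ 2 ≤
      (b - a) ^ 2 * (q τ i ^ 2 + q (flipAt i τ) i ^ 2) := by
    intro i τ
    have h1 := hone τ i
    have h2 := hone (flipAt i τ) i
    rw [flipAt_involutive i τ] at h2
    have hba : 0 ≤ b - a := by linarith
    have h3 := mul_nonneg hba (hq τ i)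
    have h4 := mul_nonneg hba (hq (flipAt i τ) i)
    set D := squareLattice.effectiveResistance (r τ) 0 v -
      squareLattice.effectiveResistance (r (flipAt i τ)) 0 v
    rcases le_total 0 D with hD | hD
    · nlinarith [sq_nonneg ((b - a) * q τ i)]
    · nlinarith [sq_nonneg ((b - a) * q (flipAt i τ) i)]
  have hsumsq : ∑ i : F, ∑ τ : F → Bool, (squareLattice.effectiveResistance (r τ) 0 v -
      squareLattice.effectiveResistance (r (flipAt i τ)) 0 v) ^ 2 ≤
      (b - a) ^ 2 * (2 * (Fintype.card (F → Bool) * K)) := by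
    calc _ ≤ ∑ i : F, ∑ τ : F → Bool, (b - a) ^ 2 * (q τ i ^ 2 + q (flipAt i τ) i ^ 2) :=
          Finset.sum_le_sum fun i _ => Finset.sum_le_sum fun τ _ => hsq i τ
      _ = (b - a) ^ 2 * (2 * ∑ τ : F → Bool, ∑ i : F, q τ i ^ 2) := by
          rw [show ∑ τ : F → Bool, ∑ i : F, q τ i ^ 2 = ∑ i : F, ∑ τ : F → Bool, q τ i ^ 2 from
            Finset.sum_comm, Finset.mul_sum, Finset.mul_sum]
          refine Finset.sum_congr rfl fun i _ => ?_
          rw [← Finset.mul_sum, Finset.sum_add_distrib,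
            sum_flipAt i fun τ => q τ i ^ 2]
          ring
      _ ≤ (b - a) ^ 2 * (2 * ∑ τ : F → Bool, K) := by
          gcongr with τ
          rw [Finset.sum_coe_sort F fun e => q τ e ^ 2]
          exact hq2 τ F
      _ = _ := by rw [Finset.sum_const, Finset.card_univ, nsmul_eq_mul]
  refine (efron_stein fun τ => squareLattice.effectiveResistance (r τ) 0 v).trans ?_
  refine (mul_le_mul_of_nonneg_left hsumsq (by positivity)).trans (le_of_eq ?_)
  rw [hK]
  ring

end LatticeNetwork

/-! ### Passage to infinitely many random edges -/

namespace LatticeNetwork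

variable {a b : ℝ} {v : ℤ × ℤ}

/-- The law of a fair coin. -/
noncomputable def coinLaw : Measure Bool :=
  (2⁻¹ : ENNReal) • Measure.dirac true + (2⁻¹ : ENNReal) • Measure.dirac false

instance isProbabilityMeasure_coinLaw : IsProbabilityMeasure coinLaw :=
  ⟨by simp [coinLaw, ENNReal.inv_two_add_inv_two]⟩

lemma coinLaw_real_singleton (t : Bool) : coinLaw.real {t} = 1 / 2 := by
  cases t <;> simp [coinLaw, Measure.real]

lemma map_coinLaw (a b : ℝ) : coinLaw.map (fun t => if t then a else b) = bernoulliLaw a b := by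
  have h : Measurable fun t : Bool => if t then a else b := measurable_of_finite _
  simp [Measure.map_dirac' h, coinLaw, bernoulliLaw, Measure.map_add _ _ h, Measure.map_smul]

/-- The law of independent fair coins on the edges of `ℤ²`. -/
noncomputable def coinsLaw : Measure (squareLattice.edgeSet → Bool) :=
  Measure.infinitePi fun _ => coinLaw

instance isProbabilityMeasure_coinsLaw : IsProbabilityMeasure coinsLaw := by
  unfold coinsLaw; infer_instance

lemma measurable_ofCoins (a b : ℝ) :
    Measurable (ofCoins a b : (squareLattice.edgeSet → Bool) → squareLattice.edgeSet → ℝ) :=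
  measurable_pi_lambda _ fun e =>
    (measurable_of_finite fun t : Bool => if t then a else b).comp (measurable_pi_apply e)

lemma map_coinsLaw (a b : ℝ) : coinsLaw.map (ofCoins a b) = resistanceLaw a b := by
  have h := Measure.infinitePi_map_pi (fun _ : squareLattice.edgeSet => coinLaw)
    (f := fun _ t => if t then a else b) fun _ => measurable_of_finite _
  simp only [map_coinLaw] at h
  exact h

lemma integral_restrict_coinsLaw (F : Finset squareLattice.edgeSet) (h : (F → Bool) → ℝ) :
    ∫ σ, h (F.restrict σ) ∂coinsLaw =
      (∑ τ, h τ) / Fintype.card (F → Bool) := by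
  rw [coinsLaw, integral_restrict_infinitePi _ (measurable_of_finite h).aestronglyMeasurable,
    integral_fintype Integrable.of_finite, Finset.sum_div]
  refine Finset.sum_congr rfl fun τ _ => ?_
  have h1 : (Measure.pi fun _ : F => coinLaw).real {τ} = ((Fintype.card (F → Bool) : ℕ) : ℝ)⁻¹ := by
    rw [Measure.real, Measure.pi_singleton, ENNReal.toReal_prod]
    change ∏ i, coinLaw.real {τ i} = _
    simp [coinLaw_real_singleton]
  rw [h1, smul_eq_mul, inv_mul_eq_div]

/-- The effective resistance as a function of the coin flips. -/
noncomputable def coinResistance (a b : ℝ) (v : ℤ × ℤ) (σ : squareLattice.edgeSet → Bool) : ℝ :=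
  squareLattice.effectiveResistance (ofCoins a b σ) 0 v

lemma coinResistance_nonneg_le (ha : 0 < a) (hab : a ≤ b) (hv : v ≠ 0)
    (σ : squareLattice.edgeSet → Bool) :
    0 ≤ coinResistance a b v σ ∧
      coinResistance a b v σ ≤ 66 * b * (1 + Real.log (1 + l1Norm v)) := by
  have hr := ofCoins_mem hab σ
  have hc := elliptic_conductance ha hr
  obtain ⟨u, hu⟩ := hc.exists_isPotential 0 v
  rw [coinResistance, effectiveResistance_eq ha hr hv.symm hu]
  have h := hu.sub_le_log hc
  rw [sub_zero, div_inv_eq_mul] at h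
  exact ⟨sub_nonneg.2 (hu.sink_le_source hc), h⟩

lemma log_le_coinResistance (ha : 0 < a) (hab : a ≤ b) (hv : 2 ≤ l1Norm v)
    (σ : squareLattice.edgeSet → Bool) :
    a / 128 * Real.log (1 + l1Norm v) ≤ coinResistance a b v σ := by
  have hv0 : v ≠ 0 := by rintro rfl; simp [l1Norm] at hv
  have hr := ofCoins_mem hab σ
  have hc := elliptic_conductance ha hr
  obtain ⟨u, hu⟩ := hc.exists_isPotential 0 v
  rw [coinResistance, effectiveResistance_eq ha hr hv0.symm hu]
  refine le_trans (le_of_eq ?_) (hu.log_le_sub hc hv)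
  field_simp

/-- Unrevealed edges get the largest resistance `b`, so the approximation lies above the limit by
monotonicity. It lies below the energy of the optimal flow for `σ` in the modified network, which
converges by dominated convergence. -/
lemma tendsto_coinResistance (ha : 0 < a) (hab : a ≤ b) (hv : v ≠ 0)
    (σ : squareLattice.edgeSet → Bool) :
    Filter.Tendsto (fun F : Finset squareLattice.edgeSet =>
      coinResistance a b v (extendCoins F (F.restrict σ))) Filter.atTop
      (nhds (coinResistance a b v σ)) := by
  have hr := ofCoins_mem hab σ
  obtain ⟨q, hq, hsum, hle, -⟩ := exists_current_sq ha hv hr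
  have hext : ∀ (F : Finset squareLattice.edgeSet) e, e ∈ F →
      ofCoins a b (extendCoins F (F.restrict σ)) e = ofCoins a b σ e := fun F e he => by
    simp [ofCoins, extendCoins, he]
  have hext' : ∀ (F : Finset squareLattice.edgeSet) e, e ∉ F →
      ofCoins a b (extendCoins F (F.restrict σ)) e = b := fun F e he => by
    simp [ofCoins, extendCoins, he]
  have hqs : Summable q := by
    refine Summable.of_nonneg_of_le hq (fun e => ?_) (hsum.summable.mul_left a⁻¹)
    rw [← mul_assoc]
    refine le_mul_of_one_le_left (hq e) ?_
    rw [inv_mul_eq_div, one_le_div ha]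
    exact (hr e).1
  have hb : 0 ≤ b := ha.le.trans hab
  have hbound : ∀ (F : Finset squareLattice.edgeSet) e,
      ‖ofCoins a b (extendCoins F (F.restrict σ)) e * q e‖ ≤ b * q e := fun F e => by
    have h := ofCoins_mem hab (extendCoins F (F.restrict σ)) e
    rw [Real.norm_eq_abs, abs_mul, abs_of_nonneg (ha.le.trans h.1), abs_of_nonneg (hq e)]
    exact mul_le_mul_of_nonneg_right h.2 (hq e)
  have hlim : Filter.Tendsto (fun F : Finset squareLattice.edgeSet =>
      ∑' e, ofCoins a b (extendCoins F (F.restrict σ)) e * q e) Filter.atTop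
      (nhds (coinResistance a b v σ)) := by
    rw [coinResistance, ← hsum.tsum_eq]
    refine tendsto_tsum_of_dominated_convergence (hqs.mul_left b) (fun e => ?_)
      (Filter.Eventually.of_forall hbound)
    refine tendsto_const_nhds.congr' ?_
    filter_upwards [Filter.eventually_ge_atTop {e}] with F hF
    rw [hext F e (hF (Finset.mem_singleton_self e))]
  refine tendsto_of_tendsto_of_tendsto_of_le_of_le tendsto_const_nhds hlim (fun F => ?_)
    fun F => ?_
  · refine effectiveResistance_mono ha hv (fun e => (hr e).1) (fun e => ?_)
      fun e => (ofCoins_mem hab _ e).2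
    by_cases he : e ∈ F
    · rw [hext F e he]
    · rw [hext' F e he]; exact (hr e).2
  · exact hle _ (fun e => ha.le.trans (ofCoins_mem hab _ e).1) _
      (Summable.of_norm_bounded (hqs.mul_left b) (hbound F)).hasSum

lemma measurable_restrict_coinResistance (a b : ℝ) (v : ℤ × ℤ)
    (F : Finset squareLattice.edgeSet) :
    Measurable fun σ : squareLattice.edgeSet → Bool =>
      coinResistance a b v (extendCoins F (F.restrict σ)) :=
  (measurable_of_finite fun τ : F → Bool => coinResistance a b v (extendCoins F τ)).comp
    (Finset.measurable_restrict F)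

lemma measurable_coinResistance (ha : 0 < a) (hab : a ≤ b) (hv : v ≠ 0) :
    Measurable (coinResistance a b v) :=
  measurable_of_tendsto_metrizable' Filter.atTop (measurable_restrict_coinResistance a b v)
    (tendsto_pi_nhds.2 (tendsto_coinResistance ha hab hv))

lemma memLp_of_bounded_coins {f : (squareLattice.edgeSet → Bool) → ℝ} (hf : Measurable f) {B : ℝ}
    (hB : ∀ σ, 0 ≤ f σ ∧ f σ ≤ B) : MemLp f 2 coinsLaw :=
  MemLp.of_bound hf.aestronglyMeasurable B (Filter.Eventually.of_forall fun σ => by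
    rw [Real.norm_eq_abs, abs_of_nonneg (hB σ).1]; exact (hB σ).2)

theorem variance_coinResistance_le (ha : 0 < a) (hab : a ≤ b) (hv : v ≠ 0) :
    variance (coinResistance a b v) coinsLaw ≤
      2376 * (b - a) ^ 2 * b ^ 4 / a ^ 4 * √(1 + Real.log (1 + l1Norm v)) := by
  set B := 66 * b * (1 + Real.log (1 + l1Norm v))
  have hB := coinResistance_nonneg_le ha hab hv
  have hm := measurable_coinResistance ha hab hv
  have hmF := measurable_restrict_coinResistance a b v
  have lim := tendsto_coinResistance ha hab hv
  rw [variance_eq_sub (memLp_of_bounded_coins hm hB)]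
  have lim1 : Filter.Tendsto (fun F : Finset squareLattice.edgeSet =>
      ∫ σ, coinResistance a b v (extendCoins F (F.restrict σ)) ∂coinsLaw) Filter.atTop
      (nhds (∫ σ, coinResistance a b v σ ∂coinsLaw)) := by
    refine tendsto_integral_filter_of_dominated_convergence (fun _ => B)
      (Filter.Eventually.of_forall fun F => (hmF F).aestronglyMeasurable)
      (Filter.Eventually.of_forall fun F => Filter.Eventually.of_forall fun σ => ?_)
      (integrable_const _) (Filter.Eventually.of_forall lim)
    rw [Real.norm_eq_abs, abs_of_nonneg (hB _).1]
    exact (hB _).2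
  have lim2 : Filter.Tendsto (fun F : Finset squareLattice.edgeSet =>
      ∫ σ, coinResistance a b v (extendCoins F (F.restrict σ)) ^ 2 ∂coinsLaw) Filter.atTop
      (nhds (∫ σ, coinResistance a b v σ ^ 2 ∂coinsLaw)) := by
    refine tendsto_integral_filter_of_dominated_convergence (fun _ => B ^ 2)
      (Filter.Eventually.of_forall fun F => ((hmF F).pow_const 2).aestronglyMeasurable)
      (Filter.Eventually.of_forall fun F => Filter.Eventually.of_forall fun σ => ?_)
      (integrable_const _) (Filter.Eventually.of_forall fun σ => (lim σ).pow 2)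
    rw [Real.norm_eq_abs, abs_of_nonneg (sq_nonneg _)]
    exact pow_le_pow_left₀ (hB _).1 (hB _).2 2
  refine le_of_tendsto (lim2.sub (lim1.pow 2)) (Filter.Eventually.of_forall fun F => ?_)
  have h := finite_variance_le ha hab hv F
  rw [integral_restrict_coinsLaw F fun τ => coinResistance a b v (extendCoins F τ) ^ 2,
    integral_restrict_coinsLaw F fun τ => coinResistance a b v (extendCoins F τ)]
  have hN : (0 : ℝ) < Fintype.card (F → Bool) := by exact_mod_cast Fintype.card_pos
  set N := ((Fintype.card (F → Bool) : ℕ) : ℝ)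
  set S₁ := ∑ τ : F → Bool, coinResistance a b v (extendCoins F τ)
  set S₂ := ∑ τ : F → Bool, coinResistance a b v (extendCoins F τ) ^ 2
  have h' : N * S₂ - S₁ ^ 2 ≤
    N ^ 2 * (2376 * (b - a) ^ 2 * b ^ 4 / a ^ 4 * √(1 + Real.log (1 + l1Norm v))) := h
  rw [← div_le_iff₀' (by positivity)] at h'
  refine le_trans (le_of_eq ?_) h'
  field_simp

/-- Measurability is only known as a function of the coins. Almost every `r` takes only the values
`a` and `b`, so coins can be decoded from it measurably; if `a = b`, decoding may lose the coins but
still recovers `r`. -/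
lemma aemeasurable_effectiveResistance (ha : 0 < a) (hab : a ≤ b) (hv : v ≠ 0) :
    AEMeasurable (fun r => squareLattice.effectiveResistance r 0 v) (resistanceLaw a b) := by
  classical
  let dec : (squareLattice.edgeSet → ℝ) → squareLattice.edgeSet → Bool := fun r e => decide (r e = a)
  have hdec : Measurable dec := by
    refine measurable_pi_lambda _ fun e => measurable_to_bool ?_
    have : (fun r : squareLattice.edgeSet → ℝ => dec r e) ⁻¹' {true} =
        (fun r : squareLattice.edgeSet → ℝ => r e) ⁻¹' {a} := by
      ext r; simp [dec]
    rw [this]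
    exact measurable_pi_apply e (measurableSet_singleton a)
  refine ⟨fun r => coinResistance a b v (dec r),
    (measurable_coinResistance ha hab hv).comp hdec, ?_⟩
  have hae : ∀ᵐ r ∂(resistanceLaw a b), r = ofCoins a b (dec r) := by
    have hset : MeasurableSet {r | r = ofCoins a b (dec r)} :=
      measurableSet_eq_fun measurable_id ((measurable_ofCoins a b).comp hdec)
    rw [← map_coinsLaw, ae_map_iff (measurable_ofCoins a b).aemeasurable hset]
    refine Filter.Eventually.of_forall fun σ => funext fun e => ?_
    simp only [dec, ofCoins]
    by_cases h : σ e <;> simp [h]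
  filter_upwards [hae] with r hr
  rw [coinResistance, ← hr]

lemma log_one_add_le {n : ℕ} (hn : 3 ≤ n) :
    1 ≤ Real.log n ∧ 1 + Real.log (1 + n) ≤ 3 * Real.log n := by
  have hn' : (3 : ℝ) ≤ n := by exact_mod_cast hn
  have h1 : 1 ≤ Real.log n := by
    rw [Real.le_log_iff_exp_le (by positivity)]
    linarith [Real.exp_one_lt_three]
  have h2 : Real.log (1 + n) ≤ 2 * Real.log n := by
    calc Real.log (1 + n) ≤ Real.log ((n : ℝ) ^ 2) := by
          gcongr
          nlinarith
      _ = _ := by rw [Real.log_pow]; norm_num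
  exact ⟨h1, by linarith⟩

end LatticeNetwork

/-! ### Conclusion -/

open LatticeNetwork

theorem theorem1 (a b : ℝ) (ha : 0 < a) (hab : a ≤ b) :
    (∀ v : ℤ × ℤ, v ≠ 0 →
      MemLp (fun r => squareLattice.effectiveResistance r 0 v) 2 (resistanceLaw a b)) ∧
    (∃ C : ℝ, 0 < C ∧ ∃ N : ℕ, ∀ v : ℤ × ℤ, N ≤ l1Norm v →
      variance (fun r => squareLattice.effectiveResistance r 0 v) (resistanceLaw a b)
        ≤ C * Real.log (l1Norm v : ℝ) ^ (2 / 3 : ℝ)) ∧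
    (∃ c C : ℝ, 0 < c ∧ 0 < C ∧ ∃ N : ℕ, ∀ v : ℤ × ℤ, N ≤ l1Norm v →
      c * Real.log (l1Norm v : ℝ)
          ≤ ∫ r, squareLattice.effectiveResistance r 0 v ∂(resistanceLaw a b) ∧
      ∫ r, squareLattice.effectiveResistance r 0 v ∂(resistanceLaw a b)
          ≤ C * Real.log (l1Norm v : ℝ)) := by
  have hb : 0 < b := ha.trans_le hab
  have hne : ∀ v : ℤ × ℤ, 3 ≤ l1Norm v → v ≠ 0 := by
    rintro v hv rfl
    simp [l1Norm] at hv
  have hmap := map_coinsLaw a b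
  have hT := (measurable_ofCoins a b).aemeasurable (μ := coinsLaw)
  have hmeas : ∀ v : ℤ × ℤ, v ≠ 0 → AEMeasurable
      (fun r => squareLattice.effectiveResistance r 0 v) (coinsLaw.map (ofCoins a b)) :=
    fun v hv => hmap ▸ aemeasurable_effectiveResistance ha hab hv
  rw [← hmap]
  have hmemLp : ∀ v : ℤ × ℤ, v ≠ 0 → MemLp (coinResistance a b v) 2 coinsLaw := fun v hv =>
    memLp_of_bounded_coins (measurable_coinResistance ha hab hv)
      (coinResistance_nonneg_le ha hab hv)
  refine ⟨fun v hv => ?_, ?_, ?_⟩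
  · rw [memLp_map_measure_iff (hmeas v hv).aestronglyMeasurable hT]
    exact hmemLp v hv
  -- The `+ 1` keeps the constant positive when `a = b`; from norm `3` on, `log |v| ≥ 1`, so the
  -- exponent `1/2` may be raised to `2/3`.
  · refine ⟨2376 * (b - a) ^ 2 * b ^ 4 / a ^ 4 * 2 + 1, by positivity, 3, fun v hv => ?_⟩
    rw [variance_map (hmeas v (hne v hv)) hT]
    refine (variance_coinResistance_le ha hab (hne v hv)).trans ?_
    obtain ⟨h1, h2⟩ := log_one_add_le hv
    set L := Real.log (l1Norm v)
    have h3 : √(1 + Real.log (1 + l1Norm v)) ≤ 2 * L ^ (2 / 3 : ℝ) := by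
      calc √(1 + Real.log (1 + l1Norm v)) ≤ √(2 ^ 2 * L) := Real.sqrt_le_sqrt (by linarith)
        _ = 2 * L ^ (1 / 2 : ℝ) := by
          rw [Real.sqrt_mul (by norm_num), Real.sqrt_sq (by norm_num), Real.sqrt_eq_rpow]
        _ ≤ 2 * L ^ (2 / 3 : ℝ) := by
          have := Real.rpow_le_rpow_of_exponent_le h1 (by norm_num : (1 / 2 : ℝ) ≤ 2 / 3)
          linarith
    have h4 : 0 ≤ L ^ (2 / 3 : ℝ) := by positivity
    calc 2376 * (b - a) ^ 2 * b ^ 4 / a ^ 4 * √(1 + Real.log (1 + l1Norm v))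
        ≤ 2376 * (b - a) ^ 2 * b ^ 4 / a ^ 4 * (2 * L ^ (2 / 3 : ℝ)) := by gcongr
      _ ≤ _ := by linarith
  · refine ⟨a / 128, 198 * b, by positivity, by positivity, 3, fun v hv => ?_⟩
    obtain ⟨h1, h2⟩ := log_one_add_le hv
    have hintegrable : Integrable (coinResistance a b v) coinsLaw :=
      (hmemLp v (hne v hv)).integrable (by norm_num)
    rw [integral_map hT (hmeas v (hne v hv)).aestronglyMeasurable]
    change _ ≤ ∫ σ, coinResistance a b v σ ∂coinsLaw ∧ ∫ σ, coinResistance a b v σ ∂coinsLaw ≤ _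
    have hconst : ∀ K : ℝ, ∫ _, K ∂coinsLaw = K := fun K => by simp
    constructor
    · rw [← hconst (a / 128 * Real.log (l1Norm v))]
      refine integral_mono (integrable_const _) hintegrable fun σ => ?_
      refine le_trans ?_ (log_le_coinResistance ha hab (by omega) σ)
      have : (0 : ℝ) < l1Norm v := by exact_mod_cast (by omega : 0 < l1Norm v)
      gcongr
      linarith
    · rw [← hconst (198 * b * Real.log (l1Norm v))]
      refine integral_mono hintegrable (integrable_const _) fun σ => ?_
      refine (coinResistance_nonneg_le ha hab (hne v hv) σ).2.trans ?_
      calc 66 * b * (1 + Real.log (1 + l1Norm v)) ≤ 66 * b * (3 * Real.log (l1Norm v)) := by gcongr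
        _ = _ := by ring
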